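/- Let $K$ be a finite abstract simplicial complex on a finite set $V$, that is, a set of subsets of $V$ (the faces) that is closed under taking subsets and contains $\emptyset$. Let $\mathbb{F}$ be a field, and let $$\mathbb{F}(K)=\mathbb{F}[v_j : j\in V]\big/\Big(\prod_{j\in\sigma}v_j \;:\; \sigma\subset V,\ \sigma\notin K\Big)$$ be its face ring (Stanley–Reisner algebra), graded so that every generator $v_j$ has degree $2$. For a face $\tau\in K$ let $\operatorname{link}_K(\tau)=\{\sigma\setminus\tau : \tau\subset\sigma\in K\}$. Call $K$ pure if all its maximal faces have the same number of elements. Let $A$ be a non-negatively graded commutative $\mathbb{F}$-algebra. A homogeneous system of parameters (hsop) of $A$ is a finite sequence $a_1,\dots,a_r$ of homogeneous, algebraically independent elements such that $A/(a_1,\dots,a_r)$ vanishes in large degrees and is finite dimensional over $\mathbb{F}$ in each degree. $A$ is Cohen–Macaulay if it has an hsop $a_1,\dots,a_r$ that is a regular sequence, i.e. $a_{i+1}$ is not a zero divisor in $A/(a_1,\dots,a_i)$ for $0\le i<r$. $A$ is Gorenstein if it is Cohen–Macaulay and, for every hsop $a_1,\dots,a_r$ of $A$, the socle $\{b\in B :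 B^{+}b=0\}$ of $B=A/(a_1,\dots,a_r)$ is isomorphic to $\mathbb{F}$ as an $\mathbb{F}$-vector space, where $B^{+}$ denotes the elements of positive degree. Then: 1. If $\mathbb{F}(K)$ is Cohen–Macaulay, then $K$ is pure and, for every face $\tau\in K$ (including $\tau=\emptyset$), $\mathbb{F}(\operatorname{link}_K(\tau))$ is Cohen–Macaulay. 2. If $\mathbb{F}(K)$ is Gorenstein, then $K$ is pure and, for every face $\tau\in K$ (including $\tau=\emptyset$), $\mathbb{F}(\operatorname{link}_K(\tau))$ is Gorenstein. -/

import Mathlib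

/-! ### Simplicial complexes

Mathlib's `PreAbstractSimplicialComplex V` records the nonempty faces only; the empty set is
counted as a face as well by `IsFace`. Elements of `V` that are not vertices of the complex are
allowed, so that the link of a face is a complex over the same `V`. -/

namespace PreAbstractSimplicialComplex

/-- The faces of `K`, including the empty face. -/
def IsFace {V : Type*} (K : PreAbstractSimplicialComplex V) (σ : Finset V) : Prop :=
  σ = ∅ ∨ σ ∈ K

/-- All maximal faces have the same dimension. -/
def IsPure {V : Type*} (K : PreAbstractSimplicialComplex V) : Prop :=
  ∀ σ τ : Finset V, Maximal K.IsFace σ → Maximal K.IsFace τ → σ.card = τ.card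

/-- The link `{τ \ σ : σ ⊆ τ ∈ K}` of a face `σ`. -/
def link {V : Type*} [DecidableEq V] (K : PreAbstractSimplicialComplex V) (σ : Finset V) :
    PreAbstractSimplicialComplex V where
  faces := {ρ | ρ.Nonempty ∧ ∃ τ : Finset V, K.IsFace τ ∧ σ ⊆ τ ∧ ρ = τ \ σ}
  isRelLowerSet_faces := by
    rintro ρ ⟨hρ, τ, hτ, hστ, rfl⟩
    refine ⟨hρ, fun t ht htne => ⟨htne, σ ∪ t, ?_, Finset.subset_union_left, ?_⟩⟩
    · have hsub : σ ∪ t ⊆ τ := Finset.union_subset hστ (ht.trans Finset.sdiff_subset)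
      rcases hτ with rfl | hτ
      · exact Or.inl (Finset.subset_empty.mp hsub)
      · exact Or.inr ((K.isRelLowerSet_faces hτ).2 hsub
          (htne.mono Finset.subset_union_right))
    · ext x
      have := @ht x
      simp only [Finset.mem_sdiff, Finset.mem_union] at this ⊢
      tauto

end PreAbstractSimplicialComplex

/-! ### Graded algebras

`𝒜 : ℕ → Submodule F A` is the family of graded pieces of a non-negatively graded commutative
`F`-algebra `A`. -/

namespace GradedPieces

variable {F A : Type*} [Field F] [CommRing A] [Algebra F A]

/-- The induced family of graded pieces on the quotient by an ideal. -/
def quotient (𝒜 : ℕ → Submodule F A) (I : Ideal A) : ℕ → Submodule F (A ⧸ I) :=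
  fun j => (𝒜 j).map (Ideal.Quotient.mkₐ F I).toLinearMap

/-- The graded pieces vanish in large degrees, and all of them are finite dimensional. -/
def IsFFinite (𝒜 : ℕ → Submodule F A) : Prop :=
  (∃ N : ℕ, ∀ j : ℕ, N ≤ j → 𝒜 j = ⊥) ∧ ∀ j : ℕ, Module.Finite F (𝒜 j)

/-- Homogeneous systems of parameters. -/
structure IsHsop (𝒜 : ℕ → Submodule F A) {r : ℕ} (a : Fin r → A) : Prop where
  homogeneous : ∀ i, SetLike.IsHomogeneousElem 𝒜 (a i)
  algebraicIndependent : AlgebraicIndependent F a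
  finite_quotient : IsFFinite (quotient 𝒜 (Ideal.span (Set.range a)))

/-- There is a homogeneous system of parameters `a₁, …, aᵣ` such that each `aᵢ₊₁` is a
non-zero-divisor on `A / (a₁, …, aᵢ)`. -/
def IsCohenMacaulay (𝒜 : ℕ → Submodule F A) : Prop :=
  ∃ (r : ℕ) (a : Fin r → A),
    IsHsop 𝒜 a ∧ RingTheory.Sequence.IsWeaklyRegular A (List.ofFn a)

/-- The socle: the elements annihilated by all elements of positive degree. -/
def socle (𝒜 : ℕ → Submodule F A) : Submodule F A where
  carrier := {b | ∀ j : ℕ, 0 < j → ∀ c ∈ 𝒜 j, c * b = 0}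
  add_mem' := fun hb hb' j hj c hc => by rw [mul_add, hb j hj c hc, hb' j hj c hc, add_zero]
  zero_mem' := fun _ _ _ _ => mul_zero _
  smul_mem' := fun t b hb j hj c hc => by rw [mul_smul_comm, hb j hj c hc, smul_zero]

/-- Cohen-Macaulay, and the socle of the quotient by any homogeneous system of parameters is
one-dimensional. -/
def IsGorenstein (𝒜 : ℕ → Submodule F A) : Prop :=
  IsCohenMacaulay 𝒜 ∧ ∀ (r : ℕ) (a : Fin r → A), IsHsop 𝒜 a →
    Nonempty (socle (quotient 𝒜 (Ideal.span (Set.range a))) ≃ₗ[F] F)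

end GradedPieces

/-! ### The face ring -/

namespace PreAbstractSimplicialComplex

/-- The ideal generated by the monomials `∏ j ∈ σ, v_j` for the non-faces `σ`. -/
noncomputable def stanleyReisnerIdeal {V : Type*} (K : PreAbstractSimplicialComplex V)
    (F : Type*) [Field F] : Ideal (MvPolynomial V F) :=
  Ideal.span {f | ∃ σ : Finset V, ¬ K.IsFace σ ∧ f = ∏ j ∈ σ, MvPolynomial.X j}

/-- The face ring (Stanley-Reisner algebra) `F(K)`. -/
abbrev FaceRing {V : Type*} (K : PreAbstractSimplicialComplex V) (F : Type*) [Field F] : Type _ :=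
  MvPolynomial V F ⧸ K.stanleyReisnerIdeal F

/-- The grading of the face ring in which all generators have degree `2`. -/
noncomputable def faceRingGrading {V : Type*} (K : PreAbstractSimplicialComplex V)
    (F : Type*) [Field F] : ℕ → Submodule F (K.FaceRing F) :=
  GradedPieces.quotient (MvPolynomial.weightedHomogeneousSubmodule F (fun _ : V => 2))
    (K.stanleyReisnerIdeal F)

end PreAbstractSimplicialComplex

/-! All statements are lifted to the polynomial ring R = F[v_j], and links of faces are reached one
vertex at a time (`link_induction`). Fix a vertex v. The star of v has ideal I_st = (I_K : v), and
the link has ideal I_st + (v); so v followed by parameters b of the link is a system of parameters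
of the star. The task is to pass from K to its star.

The bridge is the endomorphism φ = `squareVar`, which squares v and fixes the other variables. Since
R = φ(R) ⊕ vφ(R) and membership in I_K depends only on supports of monomials, R/(I_K + φ(J)R) splits
as R/(I_K + J) ⊕ R/(I_st + J) (`squareVar_add_mem_sup_map_iff`). If l is a regular system of
parameters of K, then φ(l) is a system of parameters of the same length, hence regular too; read in
the second summand, this says that l is regular on the star. Exchanging l for v, b makes b regular
on the link, provided that the lengths match.

Both exchanges rest on `IsRegularSeqMod.exchange`: over a Noetherian local ring, regularity passes
from one system of parameters to another of equal length, and so does one-dimensionality of the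
socle. It applies to R after localization at the ideal of the variables, because homogeneous ideals
are contracted from there. The companion `IsRegularSeqMod.length_le`, with the elementary symmetric
polynomials as explicit parameters, fixes the lengths. Purity follows: passing to the link of a
vertex of a facet lowers both the size of the facet and the number of parameters by one.

For Gorenstein rings, the socle modulo I_K + φ(l) is also one-dimensional. If I_K + l and I_st + l
differ, the first summand already supplies that line, so the second contributes no socle; this
forces multiplication by v to embed the socle of the star into that of K
(`hasCyclicSocle_star_of_squareVar`). -/

/-! ### Regular sequences modulo an ideal -/

namespace Ideal

section Basic

variable {R : Type*} [CommRing R]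

/-- `a` is a non-zero-divisor modulo `I`. -/
def IsRegularMod (I : Ideal R) (a : R) : Prop :=
  ∀ z, a * z ∈ I → z ∈ I

/-- The list is a (weakly) regular sequence on `R ⧸ I`. -/
def IsRegularSeqMod : Ideal R → List R → Prop
  | _, [] => True
  | I, a :: l => I.IsRegularMod a ∧ IsRegularSeqMod (I ⊔ span {a}) l

/-- Some nonzero element of `R ⧸ J` is annihilated by `𝔪`. -/
def HasSocle (𝔪 J : Ideal R) : Prop :=
  ∃ u, u ∉ J ∧ ∀ x ∈ 𝔪, x * u ∈ J

/-- The elements of `R ⧸ J` annihilated by `𝔪` are the multiples of a single nonzero one by the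
scalars `κ c`. -/
def HasCyclicSocle {F : Type*} (κ : F → R) (𝔪 J : Ideal R) : Prop :=
  ∃ u, u ∉ J ∧ (∀ x ∈ 𝔪, x * u ∈ J) ∧ ∀ z, (∀ x ∈ 𝔪, x * z ∈ J) → ∃ c, z - κ c * u ∈ J

theorem mem_sup_span_singleton' {I : Ideal R} {a z : R} :
    z ∈ I ⊔ span {a} ↔ ∃ i ∈ I, ∃ y, z = i + a * y := by
  rw [Submodule.mem_sup]
  constructor
  · rintro ⟨i, hi, y, hy, rfl⟩
    obtain ⟨t, rfl⟩ := mem_span_singleton'.1 hy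
    exact ⟨i, hi, t, by ring⟩
  · rintro ⟨i, hi, y, rfl⟩
    exact ⟨i, hi, a * y, mem_span_singleton'.2 ⟨y, mul_comm _ _⟩, rfl⟩

theorem sup_ofList_cons (I : Ideal R) (a : R) (l : List R) :
    I ⊔ ofList (a :: l) = I ⊔ span {a} ⊔ ofList l := by
  rw [ofList_cons, sup_assoc]

theorem isRegularSeqMod_append (I : Ideal R) (l l' : List R) :
    I.IsRegularSeqMod (l ++ l') ↔
      I.IsRegularSeqMod l ∧ (I ⊔ ofList l).IsRegularSeqMod l' := by
  induction l generalizing I with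
  | nil => simp [IsRegularSeqMod]
  | cons a l ih =>
    rw [List.cons_append, IsRegularSeqMod, IsRegularSeqMod, ih, sup_ofList_cons, and_assoc]

theorem isRegularSeqMod_concat (I : Ideal R) (l : List R) (a : R) :
    I.IsRegularSeqMod (l ++ [a]) ↔ I.IsRegularSeqMod l ∧ (I ⊔ ofList l).IsRegularMod a := by
  rw [isRegularSeqMod_append]
  simp [IsRegularSeqMod]

theorem sup_ofList_concat (I : Ideal R) (l : List R) (a : R) :
    I ⊔ ofList (l ++ [a]) = I ⊔ ofList l ⊔ span {a} := by
  rw [ofList_append, ofList_singleton, sup_assoc]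

theorem isRegularMod_iff_isSMulRegular {I : Ideal R} {a : R} :
    I.IsRegularMod a ↔ IsSMulRegular (R ⧸ I) a := by
  rw [isSMulRegular_iff_right_eq_zero_of_smul]
  constructor
  · intro h x hx
    obtain ⟨z, rfl⟩ := Ideal.Quotient.mk_surjective x
    rw [Algebra.smul_def, Ideal.Quotient.algebraMap_eq, ← map_mul,
      Ideal.Quotient.eq_zero_iff_mem] at hx
    exact Ideal.Quotient.eq_zero_iff_mem.2 (h z hx)
  · intro h z hz
    refine Ideal.Quotient.eq_zero_iff_mem.1 (h (Ideal.Quotient.mk I z) ?_)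
    rw [Algebra.smul_def, Ideal.Quotient.algebraMap_eq, ← map_mul]
    exact Ideal.Quotient.eq_zero_iff_mem.2 hz

theorem IsRegularMod.of_sub_mem {I : Ideal R} {a b : R} (h : I.IsRegularMod a) (hab : b - a ∈ I) :
    I.IsRegularMod b := fun z hz => h z <| by
  have : a * z = b * z - z * (b - a) := by ring
  rw [this]
  exact I.sub_mem hz (I.mul_mem_left _ hab)

/-- Prime avoidance for a coset of an ideal. -/
theorem exists_add_mem_forall_notMem (J : Ideal R) (b : R) (s : Finset (Ideal R))
    (hs : ∀ p ∈ s, p.IsPrime) (h : ∀ p ∈ s, ¬ J ⊔ span {b} ≤ p) :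
    ∃ y ∈ J, ∀ p ∈ s, b + y ∉ p := by
  classical
  induction hn : s.card generalizing s with
  | zero =>
    obtain rfl := Finset.card_eq_zero.1 hn
    exact ⟨0, J.zero_mem, by simp⟩
  | succ n ih =>
    -- A minimal q contains none of the other primes, so some element of J lies in all of them but
    -- not in q; adding it repairs q without disturbing the rest.
    obtain ⟨q, hq⟩ := s.exists_minimal (Finset.card_pos.1 (by omega))
    have hqs : q ∈ s := hq.1
    obtain ⟨y, hyJ, hy⟩ := ih (s.erase q) (fun p hp => hs p (Finset.mem_of_mem_erase hp))
      (fun p hp => h p (Finset.mem_of_mem_erase hp)) (by rw [Finset.card_erase_of_mem hqs]; omega)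
    by_cases hb : b + y ∈ q
    · have hJq : ¬ J ≤ q := by
        intro hJ
        refine h q hqs (sup_le hJ ?_)
        rw [span_singleton_le_iff_mem]
        simpa using q.sub_mem hb (hJ hyJ)
      have hq' := hs q hqs
      have hprod : ¬ J ⊓ (s.erase q).inf id ≤ q := by
        rw [hq'.inf_le, not_or]
        refine ⟨hJq, fun hle => ?_⟩
        obtain ⟨p, hp, hpq⟩ := (hq'.inf_le').1 hle
        exact (Finset.ne_of_mem_erase hp)
          (le_antisymm hpq (hq.2 (Finset.mem_of_mem_erase hp) hpq))
      obtain ⟨t, ht, htq⟩ := SetLike.not_le_iff_exists.1 hprod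
      refine ⟨y + t, J.add_mem hyJ ht.1, fun p hp => ?_⟩
      by_cases hpq : p = q
      · subst hpq
        intro hmem
        exact htq (by simpa using p.sub_mem hmem hb)
      · have hp' : p ∈ s.erase q := Finset.mem_erase.2 ⟨hpq, hp⟩
        have htp : t ∈ p := (Finset.inf_le (f := id) hp' : (s.erase q).inf id ≤ p) ht.2
        intro hmem
        exact hy p hp' (by simpa [← add_assoc] using p.sub_mem hmem htp)
    · refine ⟨y, hyJ, fun p hp => ?_⟩
      by_cases hpq : p = q
      · exact hpq ▸ hb
      · exact hy p (Finset.mem_erase.2 ⟨hpq, hp⟩)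

/-- If `b` together with `J'` generates an ideal containing, up to radical, a non-zero-divisor
modulo `J`, then some element of the coset `b + J'` is a non-zero-divisor modulo `J`. -/
theorem exists_isRegularMod_add [IsNoetherianRing R] {J J' : Ideal R} {a b : R}
    (ha : J.IsRegularMod a) (hab : a ∈ (J ⊔ (J' ⊔ span {b})).radical) :
    ∃ y ∈ J', J.IsRegularMod (b + y) := by
  have hfin := associatedPrimes.finite R (R ⧸ J)
  obtain ⟨y, hy, hys⟩ := exists_add_mem_forall_notMem J' b hfin.toFinset
    (fun p hp => (hfin.mem_toFinset.1 hp).1) (fun p hp hle => by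
      have hp' : p ∈ associatedPrimes R (R ⧸ J) := hfin.mem_toFinset.1 hp
      have hJp : J ≤ p := by
        simpa [Submodule.annihilator_top, Ideal.annihilator_quotient] using
          IsAssociatedPrime.annihilator_le hp'
      -- An associated prime containing J' and b would contain a, which is a non-zero-divisor.
      have hap : a ∈ p := (hp'.1.radical_le_iff.2 (sup_le hJp hle)) hab
      have : a ∈ ⋃ p ∈ associatedPrimes R (R ⧸ J), (p : Set R) := Set.mem_biUnion hp' hap
      rw [biUnion_associatedPrimes_eq_compl_regular] at this
      exact this (isRegularMod_iff_isSMulRegular.1 ha))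
  refine ⟨y, hy, ?_⟩
  rw [isRegularMod_iff_isSMulRegular]
  by_contra hcon
  have : b + y ∈ ⋃ p ∈ associatedPrimes R (R ⧸ J), (p : Set R) := by
    rw [biUnion_associatedPrimes_eq_compl_regular]
    exact hcon
  obtain ⟨p, hp, hbp⟩ := Set.mem_iUnion₂.1 this
  exact hys p (hfin.mem_toFinset.2 hp) hbp

/-- The correspondence `u ↦ w` with `c * u = a * w` between the socles modulo two
non-zero-divisors. -/
theorem exists_socle_exchange {𝔪 J : Ideal R} {a c u : R} (ha : J.IsRegularMod a) (hc : c ∈ 𝔪)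
    (hu : ∀ x ∈ 𝔪, x * u ∈ J ⊔ span {a}) :
    ∃ w, c * u - a * w ∈ J ∧ ∀ x ∈ 𝔪, x * w ∈ J ⊔ span {c} := by
  obtain ⟨j, hj, w, hw⟩ := mem_sup_span_singleton'.1 (hu c hc)
  refine ⟨w, by rw [hw]; simpa using hj, fun x hx => ?_⟩
  obtain ⟨j', hj', y, hy⟩ := mem_sup_span_singleton'.1 (hu x hx)
  refine mem_sup_span_singleton'.2 ⟨x * w - c * y, ha _ ?_, y, by ring⟩
  have : a * (x * w - c * y) = c * j' - x * j := by linear_combination c * hy - x * hw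
  rw [this]
  exact J.sub_mem (J.mul_mem_left _ hj') (J.mul_mem_left _ hj)

theorem notMem_of_socle_exchange {J : Ideal R} {a c u w : R} (hc : J.IsRegularMod c)
    (hu : u ∉ J ⊔ span {a}) (hw : c * u - a * w ∈ J) : w ∉ J ⊔ span {c} := by
  intro hmem
  obtain ⟨j, hj, y, rfl⟩ := mem_sup_span_singleton'.1 hmem
  refine hu (mem_sup_span_singleton'.2 ⟨u - a * y, hc _ ?_, y, by ring⟩)
  have : c * (u - a * y) = (c * u - a * (j + c * y)) + a * j := by ring
  rw [this]
  exact J.add_mem hw (J.mul_mem_left _ hj)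

theorem HasSocle.exchange {𝔪 J : Ideal R} {a c : R} (ha : J.IsRegularMod a)
    (hc : J.IsRegularMod c) (hcm : c ∈ 𝔪) (h : HasSocle 𝔪 (J ⊔ span {a})) :
    HasSocle 𝔪 (J ⊔ span {c}) := by
  obtain ⟨u, hu, hmu⟩ := h
  obtain ⟨w, hw, hmw⟩ := exists_socle_exchange ha hcm hmu
  exact ⟨w, notMem_of_socle_exchange hc hu hw, hmw⟩

/-- The exchange is applied in both directions: z is carried back to the socle modulo a, expressed
there through u, and the relation is then divided by a. -/
theorem HasCyclicSocle.exchange {F : Type*} {κ : F → R} {𝔪 J : Ideal R} {a c : R}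
    (ha : J.IsRegularMod a) (hc : J.IsRegularMod c) (ham : a ∈ 𝔪) (hcm : c ∈ 𝔪)
    (h : HasCyclicSocle κ 𝔪 (J ⊔ span {a})) : HasCyclicSocle κ 𝔪 (J ⊔ span {c}) := by
  obtain ⟨u, hu, hmu, hspan⟩ := h
  obtain ⟨w, hw, hmw⟩ := exists_socle_exchange ha hcm hmu
  refine ⟨w, notMem_of_socle_exchange hc hu hw, hmw, fun z hz => ?_⟩
  obtain ⟨z', hz', hmz'⟩ := exists_socle_exchange hc ham hz
  obtain ⟨k, hk⟩ := hspan z' hmz'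
  obtain ⟨j, hj, t, ht⟩ := mem_sup_span_singleton'.1 hk
  refine ⟨k, mem_sup_span_singleton'.2 ⟨z - κ k * w - c * t, ha _ ?_, t, by ring⟩⟩
  have : a * (z - κ k * w - c * t) = (a * z - c * z') + κ k * (c * u - a * w) + c * j := by
    linear_combination c * ht
  rw [this]
  exact J.add_mem (J.add_mem hz' (J.mul_mem_left _ hw)) (J.mul_mem_left _ hj)

end Basic

/-! ### Exchange of regular sequences in a Noetherian local ring -/

section Local

variable {R : Type*} [CommRing R] [IsLocalRing R] [IsNoetherianRing R]

open IsLocalRing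

/-- Let L = (I : b). Regularity of b modulo I + (a), then of a modulo I, gives L ⊆ I + aL, and
Nakayama yields L ⊆ I. This is where locality enters; the second claim is formal. -/
theorem IsRegularMod.swap {I : Ideal R} {a b : R} (ham : a ∈ maximalIdeal R)
    (ha : I.IsRegularMod a) (hb : (I ⊔ span {a}).IsRegularMod b) :
    I.IsRegularMod b ∧ (I ⊔ span {b}).IsRegularMod a := by
  constructor
  · let L : Ideal R := Submodule.comap (LinearMap.mulLeft R b) I
    have hL : ∀ z, z ∈ L ↔ b * z ∈ I := fun z => Iff.rfl
    have hle : L ≤ I := by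
      refine Submodule.le_of_le_smul_of_le_jacobson_bot (I := maximalIdeal R)
        (IsNoetherian.noetherian L) (IsLocalRing.maximalIdeal_le_jacobson _) ?_
      intro z hz
      obtain ⟨i, hi, y, rfl⟩ :=
        mem_sup_span_singleton'.1 (hb z (Submodule.mem_sup_left ((hL z).1 hz)))
      refine Submodule.add_mem_sup hi (Submodule.smul_mem_smul ham ((hL y).2 (ha _ ?_)))
      have : a * (b * y) = b * (i + a * y) - b * i := by ring
      rw [this]
      exact I.sub_mem ((hL _).1 hz) (I.mul_mem_left _ hi)
    exact fun z hz => hle ((hL z).2 hz)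
  · intro z hz
    obtain ⟨i, hi, w, hw⟩ := mem_sup_span_singleton'.1 hz
    have hbw : b * w ∈ I ⊔ span {a} :=
      mem_sup_span_singleton'.2 ⟨-i, I.neg_mem hi, z, by linear_combination -hw⟩
    obtain ⟨j, hj, y, rfl⟩ := mem_sup_span_singleton'.1 (hb w hbw)
    refine mem_sup_span_singleton'.2 ⟨z - b * y, ha _ ?_, y, by ring⟩
    have : a * (z - b * y) = i + b * j := by linear_combination hw
    rw [this]
    exact I.add_mem hi (I.mul_mem_left _ hj)

theorem isRegularSeqMod_cons_cons_comm {I : Ideal R} {a b : R} {l : List R}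
    (ham : a ∈ maximalIdeal R) (h : I.IsRegularSeqMod (a :: b :: l)) :
    I.IsRegularSeqMod (b :: a :: l) := by
  obtain ⟨ha, hb, hl⟩ := h
  obtain ⟨hb', ha'⟩ := ha.swap ham hb
  exact ⟨hb', ha', by rwa [sup_right_comm]⟩

theorem isRegularSeqMod_concat_iff_cons {I : Ideal R} {c : R} {l : List R}
    (hc : c ∈ maximalIdeal R) (hl : ∀ a ∈ l, a ∈ maximalIdeal R) :
    I.IsRegularSeqMod (l ++ [c]) ↔ I.IsRegularSeqMod (c :: l) := by
  induction l generalizing I with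
  | nil => rfl
  | cons a l ih =>
    have ha : a ∈ maximalIdeal R := hl a (by simp)
    rw [List.cons_append, IsRegularSeqMod, ih (fun x hx => hl x (by simp [hx]))]
    exact ⟨fun h => isRegularSeqMod_cons_cons_comm ha h,
      fun h => isRegularSeqMod_cons_cons_comm hc h⟩

/-- Two sequences of the same length, one of them regular and contained in the radical of the ideal
generated by the other: the other one is regular as well, and the socles of the quotients agree. -/
theorem IsRegularSeqMod.exchange {F : Type*} (κ : F → R) {I : Ideal R} {as bs : List R}
    (hlen : as.length = bs.length)
    (ham : ∀ a ∈ as, a ∈ maximalIdeal R) (hbm : ∀ b ∈ bs, b ∈ maximalIdeal R)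
    (hreg : I.IsRegularSeqMod as) (hrad : ∀ a ∈ as, a ∈ (I ⊔ ofList bs).radical) :
    I.IsRegularSeqMod bs ∧
      (HasSocle (maximalIdeal R) (I ⊔ ofList bs) → HasSocle (maximalIdeal R) (I ⊔ ofList as)) ∧
      (HasCyclicSocle κ (maximalIdeal R) (I ⊔ ofList as) →
        HasCyclicSocle κ (maximalIdeal R) (I ⊔ ofList bs)) := by
  induction hn : as.length generalizing I as bs with
  | zero =>
    obtain rfl := List.length_eq_zero_iff.1 hn
    obtain rfl := List.length_eq_zero_iff.1 (hlen.symm.trans hn)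
    exact ⟨trivial, id, id⟩
  | succ n ih =>
    obtain ⟨as, a, rfl⟩ : ∃ l x, as = l ++ [x] :=
      ⟨_, _, (List.dropLast_append_getLast (List.ne_nil_of_length_pos (by omega))).symm⟩
    obtain ⟨bs, b, rfl⟩ : ∃ l x, bs = l ++ [x] :=
      ⟨_, _, (List.dropLast_append_getLast (List.ne_nil_of_length_pos (by omega))).symm⟩
    simp only [List.length_append, List.length_singleton, Nat.add_right_cancel_iff] at hlen hn
    simp only [List.mem_append, List.mem_singleton, or_imp, forall_and, forall_eq] at ham hbm hrad
    rw [isRegularSeqMod_concat] at hreg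
    -- Prime avoidance replaces b by an element c of b + (bs) that is regular modulo I and `as`. The
    -- ideal generated with `bs` is unchanged, and c can move to the front, so the induction runs
    -- over I + (c) with both lists one shorter.
    obtain ⟨y, hy, hc⟩ := exists_isRegularMod_add (J' := ofList bs) (b := b) hreg.2 <| by
      refine radical_mono ?_ hrad.2
      rw [sup_ofList_concat, sup_assoc]
      exact sup_le_sup_right le_sup_left _
    set c := b + y with hcdef
    have hle : ofList bs ≤ maximalIdeal R := span_le.2 fun x hx => hbm.1 x hx
    have hcm : c ∈ maximalIdeal R := Ideal.add_mem _ hbm.2 (hle hy)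
    have hideal : I ⊔ span {c} ⊔ ofList bs = I ⊔ ofList (bs ++ [b]) := by
      rw [ofList_append, ofList_singleton, sup_assoc]
      congr 1
      apply le_antisymm
      · refine sup_le ?_ le_sup_left
        rw [span_singleton_le_iff_mem]
        exact Ideal.add_mem _ (Submodule.mem_sup_right (mem_span_singleton_self b))
          (Submodule.mem_sup_left hy)
      · refine sup_le le_sup_right ?_
        rw [span_singleton_le_iff_mem]
        have : b = c - y := by rw [hcdef]; ring
        rw [this]
        exact Ideal.sub_mem _ (Submodule.mem_sup_left (mem_span_singleton_self c))
          (Submodule.mem_sup_right hy)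
    have hcas : I.IsRegularSeqMod (c :: as) := by
      rw [← isRegularSeqMod_concat_iff_cons hcm ham.1, isRegularSeqMod_concat]
      exact ⟨hreg.1, hc⟩
    obtain ⟨h1, h2, h3⟩ := ih (I := I ⊔ span {c}) hlen ham.1 hbm.1 hcas.2
      (by rw [hideal]; exact hrad.1) hn
    rw [hideal, sup_right_comm] at h2 h3
    have hcbs : I.IsRegularSeqMod (bs ++ [c]) :=
      (isRegularSeqMod_concat_iff_cons hcm hbm.1).2 ⟨hcas.1, h1⟩
    rw [isRegularSeqMod_concat] at hcbs
    refine ⟨?_, ?_, ?_⟩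
    · rw [isRegularSeqMod_concat]
      refine ⟨hcbs.1, hcbs.2.of_sub_mem ?_⟩
      have : b - c = -y := by rw [hcdef]; ring
      rw [this]
      exact neg_mem (Submodule.mem_sup_right hy)
    · rw [sup_ofList_concat I as]
      exact fun h => (h2 h).exchange hc hreg.2 ham.2
    · rw [sup_ofList_concat I as]
      exact fun h => h3 (h.exchange hreg.2 hc ham.2 hcm)

/-- If `as` were longer, exchanging its initial segment of length |bs| with `bs` would give a
nonzero socle element modulo that segment. The next member of `as` kills it, against regularity. -/
theorem IsRegularSeqMod.length_le {I : Ideal R} {as bs : List R}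
    (ham : ∀ a ∈ as, a ∈ maximalIdeal R) (hbm : ∀ b ∈ bs, b ∈ maximalIdeal R)
    (hreg : I.IsRegularSeqMod as) (hrad : ∀ a ∈ as, a ∈ (I ⊔ ofList bs).radical)
    (hsoc : HasSocle (maximalIdeal R) (I ⊔ ofList bs)) : as.length ≤ bs.length := by
  by_contra! hlt
  rw [← List.take_append_drop bs.length as, isRegularSeqMod_append] at hreg
  have hmem : ∀ a ∈ as.take bs.length, a ∈ as := fun a ha => List.mem_of_mem_take ha
  obtain ⟨u, hu, hmu⟩ := (hreg.1.exchange (id : R → R) (by simp; omega)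
    (fun a ha => ham a (hmem a ha)) hbm (fun a ha => hrad a (hmem a ha))).2.1 hsoc
  rw [List.drop_eq_getElem_cons hlt] at hreg
  exact hu (hreg.2.1 u (hmu _ (ham _ (List.getElem_mem _))))

end Local

end Ideal

/-! ### Localization at a maximal ideal -/

namespace Ideal

section Socle

variable {R : Type*} [CommRing R]

/-- An ideal not contained in an `𝔪`-primary ideal `J` meets the socle of `R ⧸ J`. -/
theorem exists_mem_socle {𝔪 J H : Ideal R} (hfg : 𝔪.FG) (hrad : 𝔪 ≤ J.radical) (hH : ¬ H ≤ J) :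
    ∃ u ∈ H, u ∉ J ∧ ∀ x ∈ 𝔪, x * u ∈ J := by
  classical
  -- The least such N is positive since H is not contained in J; an element of 𝔪^(N-1) H outside J
  -- is then a socle element.
  have hex : ∃ N, 𝔪 ^ N * H ≤ J := by
    obtain ⟨N, hN⟩ := exists_pow_le_of_le_radical_of_fg hrad hfg
    exact ⟨N, (mul_le_left).trans hN⟩
  have hpos : Nat.find hex ≠ 0 := by
    intro h0
    have := Nat.find_spec hex
    rw [h0, pow_zero, one_eq_top, top_mul] at this
    exact hH this
  obtain ⟨N, hN⟩ := Nat.exists_eq_succ_of_ne_zero hpos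
  have hnot : ¬ 𝔪 ^ N * H ≤ J := Nat.find_min hex (by omega)
  have hspec := Nat.find_spec hex
  obtain ⟨u, hu, huJ⟩ := SetLike.not_le_iff_exists.1 hnot
  refine ⟨u, mul_le_right hu, huJ, fun x hx => hspec ?_⟩
  rw [hN, pow_succ', mul_assoc]
  exact mul_mem_mul hx hu

theorem hasSocle_of_le_radical {𝔪 J : Ideal R} (hfg : 𝔪.FG) (hrad : 𝔪 ≤ J.radical)
    (hJ : J ≠ ⊤) : HasSocle 𝔪 J := by
  obtain ⟨u, -, hu⟩ := exists_mem_socle (H := ⊤) hfg hrad (by rwa [top_le_iff])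
  exact ⟨u, hu⟩

/-- Elements outside of `𝔪` are non-zero-divisors modulo `J`. -/
def IsSaturatedAt (𝔪 J : Ideal R) : Prop :=
  ∀ s ∉ 𝔪, J.IsRegularMod s

theorem exists_mul_sub_one_mem {𝔪 J : Ideal R} [h𝔪 : 𝔪.IsMaximal] (hrad : 𝔪 ≤ J.radical) {s : R}
    (hs : s ∉ 𝔪) : ∃ t, t * s - 1 ∈ J := by
  have htop : J ⊔ span {s} = ⊤ := by
    by_contra hne
    obtain ⟨M, hM, hle⟩ := exists_le_maximal _ hne
    have h1 : 𝔪 ≤ M := hrad.trans (hM.isPrime.radical_le_iff.2 (le_sup_left.trans hle))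
    have h2 : 𝔪 = M := h𝔪.eq_of_le hM.ne_top h1
    exact hs (h2 ▸ hle (Submodule.mem_sup_right (mem_span_singleton_self s)))
  obtain ⟨j, hj, t, ht⟩ := mem_sup_span_singleton'.1 ((eq_top_iff_one _).1 htop)
  refine ⟨t, ?_⟩
  have : t * s - 1 = -j := by linear_combination -ht
  rw [this]
  exact J.neg_mem hj

theorem isSaturatedAt_of_le_radical {𝔪 J : Ideal R} [𝔪.IsMaximal] (hrad : 𝔪 ≤ J.radical) :
    IsSaturatedAt 𝔪 J := by
  intro s hs z hz
  obtain ⟨t, ht⟩ := exists_mul_sub_one_mem hrad hs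
  have : z = t * (s * z) - z * (t * s - 1) := by ring
  rw [this]
  exact J.sub_mem (J.mul_mem_left _ hz) (J.mul_mem_left _ ht)

end Socle

/-! ### Passage to the localization at a maximal ideal and back -/

section AtPrime

variable {R : Type*} [CommRing R] (𝔪 : Ideal R) [h𝔪 : 𝔪.IsMaximal]

theorem IsRegularMod.map_atPrime {I : Ideal R} {a : R} (h : I.IsRegularMod a) :
    (I.map (algebraMap R (Localization.AtPrime 𝔪))).IsRegularMod (algebraMap R _ a) := by
  intro z hz
  obtain ⟨p, s, rfl⟩ := IsLocalization.exists_mk'_eq 𝔪.primeCompl z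
  rw [IsLocalization.mul_mk'_eq_mk'_of_mul, IsLocalization.mk'_mem_map_algebraMap_iff] at hz
  rw [IsLocalization.mk'_mem_map_algebraMap_iff]
  obtain ⟨t, ht, htz⟩ := hz
  exact ⟨t, ht, h _ (by rwa [mul_left_comm])⟩

theorem IsRegularSeqMod.map_atPrime {I : Ideal R} {l : List R} (h : I.IsRegularSeqMod l) :
    (I.map (algebraMap R (Localization.AtPrime 𝔪))).IsRegularSeqMod
      (l.map (algebraMap R (Localization.AtPrime 𝔪))) := by
  induction l generalizing I with
  | nil => trivial
  | cons a l ih =>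
    refine ⟨h.1.map_atPrime 𝔪, ?_⟩
    have := ih h.2
    rwa [Ideal.map_sup, map_span, Set.image_singleton] at this

variable {𝔪}

theorem IsSaturatedAt.algebraMap_mem_map_iff {I : Ideal R} (h : IsSaturatedAt 𝔪 I) {z : R} :
    algebraMap R (Localization.AtPrime 𝔪) z ∈ I.map (algebraMap R (Localization.AtPrime 𝔪)) ↔
      z ∈ I := by
  refine ⟨fun hz => ?_, fun hz => mem_map_of_mem _ hz⟩
  obtain ⟨s, hs, hsz⟩ :=
    (IsLocalization.algebraMap_mem_map_algebraMap_iff 𝔪.primeCompl _ I z).1 hz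
  exact h s hs z hsz

/-- Saturation at every stage makes each partial ideal the contraction of its extension, so
regularity descends step by step. -/
theorem IsRegularSeqMod.of_map_atPrime {I : Ideal R} {l : List R}
    (h : (I.map (algebraMap R (Localization.AtPrime 𝔪))).IsRegularSeqMod
      (l.map (algebraMap R (Localization.AtPrime 𝔪))))
    (hsat : ∀ i, IsSaturatedAt 𝔪 (I ⊔ ofList (l.take i))) : I.IsRegularSeqMod l := by
  induction l generalizing I with
  | nil => trivial
  | cons a l ih =>
    refine ⟨fun z hz => ?_, ih ?_ fun i => ?_⟩
    · have h0 := hsat 0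
      simp only [List.take_zero, ofList_nil, sup_bot_eq] at h0
      rw [← h0.algebraMap_mem_map_iff]
      refine h.1 _ ?_
      rw [← map_mul]
      exact mem_map_of_mem _ hz
    · have := h.2
      rwa [Ideal.map_sup, map_span, Set.image_singleton]
    · have := hsat (i + 1)
      rwa [List.take_succ_cons, sup_ofList_cons] at this

theorem forall_mem_maximalIdeal_mul_mem_map_iff {J : Ideal R} (hrad : 𝔪 ≤ J.radical) {z : R} :
    (∀ x ∈ IsLocalRing.maximalIdeal (Localization.AtPrime 𝔪),
      x * algebraMap R _ z ∈ J.map (algebraMap R (Localization.AtPrime 𝔪))) ↔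
    ∀ x ∈ 𝔪, x * z ∈ J := by
  have hsat := isSaturatedAt_of_le_radical hrad
  rw [← Localization.AtPrime.map_eq_maximalIdeal]
  constructor
  · intro h x hx
    rw [← hsat.algebraMap_mem_map_iff, map_mul]
    exact h _ (mem_map_of_mem _ hx)
  · intro h x hx
    have hle : 𝔪.map (algebraMap R (Localization.AtPrime 𝔪)) ≤
        Submodule.comap (LinearMap.mulRight (Localization.AtPrime 𝔪) (algebraMap R _ z))
          (J.map (algebraMap R (Localization.AtPrime 𝔪))) := by
      rw [map_le_iff_le_comap]
      intro y hy
      rw [mem_comap, Submodule.mem_comap, LinearMap.mulRight_apply, ← map_mul]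
      exact mem_map_of_mem _ (h y hy)
    exact hle hx

/-- Denominators are already invertible modulo J, so localizing does not change the quotient. This
is why socles may be compared before or after localization. -/
theorem exists_sub_algebraMap_mem_map {J : Ideal R} (hrad : 𝔪 ≤ J.radical)
    (z : Localization.AtPrime 𝔪) :
    ∃ p : R, z - algebraMap R _ p ∈ J.map (algebraMap R (Localization.AtPrime 𝔪)) := by
  obtain ⟨p, s, rfl⟩ := IsLocalization.exists_mk'_eq 𝔪.primeCompl z
  obtain ⟨t, ht⟩ := exists_mul_sub_one_mem hrad s.2
  refine ⟨t * p, ?_⟩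
  rw [← unit_mul_mem_iff_mem _ (IsLocalization.map_units (Localization.AtPrime 𝔪) s), mul_sub,
    IsLocalization.mk'_spec', ← map_mul, ← map_sub]
  refine mem_map_of_mem _ ?_
  have : p - (s : R) * (t * p) = -(p * (t * s - 1)) := by ring
  rw [this]
  exact J.neg_mem (J.mul_mem_left _ ht)

theorem hasCyclicSocle_map_iff {F : Type*} {κ : F → R} {J : Ideal R} (hrad : 𝔪 ≤ J.radical) :
    HasCyclicSocle (fun c => algebraMap R (Localization.AtPrime 𝔪) (κ c))
      (IsLocalRing.maximalIdeal _) (J.map (algebraMap R (Localization.AtPrime 𝔪))) ↔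
    HasCyclicSocle κ 𝔪 J := by
  have hsat := isSaturatedAt_of_le_radical hrad
  set J' := J.map (algebraMap R (Localization.AtPrime 𝔪)) with hJ'
  have key : ∀ z z' : Localization.AtPrime 𝔪, z - z' ∈ J' → ∀ x, (x * z ∈ J' ↔ x * z' ∈ J') := by
    intro z z' h x
    have : x * z = x * z' + x * (z - z') := by ring
    rw [this]
    exact J'.add_mem_iff_left (J'.mul_mem_left _ h)
  constructor
  · rintro ⟨u, hu, hmu, hspan⟩
    obtain ⟨p, hp⟩ := exists_sub_algebraMap_mem_map hrad u
    refine ⟨p, fun hpJ => hu ?_, ?_, fun z hz => ?_⟩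
    · simpa using J'.add_mem hp (mem_map_of_mem _ hpJ)
    · rw [← forall_mem_maximalIdeal_mul_mem_map_iff hrad]
      exact fun x hx => (key _ _ hp x).1 (hmu x hx)
    · obtain ⟨c, hc⟩ := hspan _ ((forall_mem_maximalIdeal_mul_mem_map_iff hrad).2 hz)
      refine ⟨c, ?_⟩
      rw [← hsat.algebraMap_mem_map_iff, map_sub, map_mul]
      have := J'.add_mem hc (J'.mul_mem_left (algebraMap R _ (κ c)) hp)
      convert this using 1
      ring
  · rintro ⟨u, hu, hmu, hspan⟩
    refine ⟨algebraMap R _ u, fun h => hu (hsat.algebraMap_mem_map_iff.1 h),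
      (forall_mem_maximalIdeal_mul_mem_map_iff hrad).2 hmu, fun z hz => ?_⟩
    obtain ⟨p, hp⟩ := exists_sub_algebraMap_mem_map hrad z
    obtain ⟨c, hc⟩ := hspan p ((forall_mem_maximalIdeal_mul_mem_map_iff hrad).1
      fun x hx => (key _ _ hp x).1 (hz x hx))
    refine ⟨c, ?_⟩
    have := J'.add_mem hp (mem_map_of_mem (algebraMap R (Localization.AtPrime 𝔪)) hc)
    rw [map_sub, map_mul] at this
    convert this using 1
    ring

theorem forall_mem_map_mem_maximalIdeal {l : List R} (hl : ∀ a ∈ l, a ∈ 𝔪) :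
    ∀ a ∈ l.map (algebraMap R (Localization.AtPrime 𝔪)),
      a ∈ IsLocalRing.maximalIdeal (Localization.AtPrime 𝔪) := by
  intro a ha
  obtain ⟨b, hb, rfl⟩ := List.mem_map.1 ha
  rw [← Localization.AtPrime.map_eq_maximalIdeal]
  exact mem_map_of_mem _ (hl b hb)

theorem map_sup_ofList (I : Ideal R) (l : List R) :
    (I ⊔ ofList l).map (algebraMap R (Localization.AtPrime 𝔪)) =
      I.map (algebraMap R (Localization.AtPrime 𝔪)) ⊔
        ofList (l.map (algebraMap R (Localization.AtPrime 𝔪))) := by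
  rw [Ideal.map_sup, map_ofList]

theorem maximalIdeal_le_radical_map {J : Ideal R} (hrad : 𝔪 ≤ J.radical) :
    IsLocalRing.maximalIdeal (Localization.AtPrime 𝔪) ≤
      (J.map (algebraMap R (Localization.AtPrime 𝔪))).radical := by
  rw [← Localization.AtPrime.map_eq_maximalIdeal]
  exact (map_mono hrad).trans (map_radical_le _)

variable [IsNoetherianRing R]

theorem IsRegularSeqMod.exchange_of_isSaturatedAt {I : Ideal R} {as bs : List R}
    (hlen : as.length = bs.length) (ham : ∀ a ∈ as, a ∈ 𝔪) (hbm : ∀ b ∈ bs, b ∈ 𝔪)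
    (hreg : I.IsRegularSeqMod as) (hrad : 𝔪 ≤ (I ⊔ ofList bs).radical)
    (hsat : ∀ i, IsSaturatedAt 𝔪 (I ⊔ ofList (bs.take i))) : I.IsRegularSeqMod bs := by
  refine IsRegularSeqMod.of_map_atPrime (𝔪 := 𝔪) ?_ hsat
  refine ((hreg.map_atPrime 𝔪).exchange (id : _ → Localization.AtPrime 𝔪) (by simpa using hlen)
    (forall_mem_map_mem_maximalIdeal ham) (forall_mem_map_mem_maximalIdeal hbm) fun a ha => ?_).1
  rw [← map_sup_ofList]
  exact maximalIdeal_le_radical_map hrad (forall_mem_map_mem_maximalIdeal ham a ha)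

theorem IsRegularSeqMod.hasCyclicSocle_exchange {F : Type*} {κ : F → R} {I : Ideal R}
    {as bs : List R}
    (hlen : as.length = bs.length) (ham : ∀ a ∈ as, a ∈ 𝔪) (hbm : ∀ b ∈ bs, b ∈ 𝔪)
    (hreg : I.IsRegularSeqMod as) (hrada : 𝔪 ≤ (I ⊔ ofList as).radical)
    (hradb : 𝔪 ≤ (I ⊔ ofList bs).radical) (h : HasCyclicSocle κ 𝔪 (I ⊔ ofList as)) :
    HasCyclicSocle κ 𝔪 (I ⊔ ofList bs) := by
  rw [← hasCyclicSocle_map_iff hradb, map_sup_ofList]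
  rw [← hasCyclicSocle_map_iff hrada, map_sup_ofList] at h
  refine ((hreg.map_atPrime 𝔪).exchange _ (by simpa using hlen)
    (forall_mem_map_mem_maximalIdeal ham) (forall_mem_map_mem_maximalIdeal hbm)
      fun a ha => ?_).2.2 h
  rw [← map_sup_ofList]
  exact maximalIdeal_le_radical_map hradb (forall_mem_map_mem_maximalIdeal ham a ha)

theorem IsRegularSeqMod.length_le_of_le_radical {I : Ideal R} {as bs : List R} (hI : I ≤ 𝔪)
    (ham : ∀ a ∈ as, a ∈ 𝔪) (hbm : ∀ b ∈ bs, b ∈ 𝔪) (hreg : I.IsRegularSeqMod as)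
    (hrad : 𝔪 ≤ (I ⊔ ofList bs).radical) : as.length ≤ bs.length := by
  have hrad' := maximalIdeal_le_radical_map hrad
  rw [map_sup_ofList] at hrad'
  have := (hreg.map_atPrime 𝔪).length_le (bs := bs.map (algebraMap R (Localization.AtPrime 𝔪)))
    (forall_mem_map_mem_maximalIdeal ham) (forall_mem_map_mem_maximalIdeal hbm)
    (fun a ha => hrad' (forall_mem_map_mem_maximalIdeal ham a ha))
    (hasSocle_of_le_radical (IsNoetherian.noetherian _) hrad' ?_)
  · simpa using this
  · refine ne_top_of_le_ne_top (IsLocalRing.maximalIdeal.isMaximal _).ne_top (sup_le ?_ ?_)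
    · rw [← Localization.AtPrime.map_eq_maximalIdeal]
      exact map_mono hI
    · exact span_le.2 fun x hx => forall_mem_map_mem_maximalIdeal hbm x hx

end AtPrime

end Ideal

/-! ### Homogeneous ideals of a polynomial ring -/

namespace MvPolynomial

variable {σ F : Type*} [Field F]

theorem mem_idealOfVars_iff {p : MvPolynomial σ F} :
    p ∈ idealOfVars σ F ↔ constantCoeff p = 0 := by
  have := mem_pow_idealOfVars_iff' (σ := σ) 1 p
  rw [pow_one] at this
  rw [this, constantCoeff_eq]
  constructor
  · exact fun h => h 0 (by simp)
  · intro h x hx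
    rwa [(Finsupp.degree_eq_zero_iff x).1 (by omega)]

theorem idealOfVars_eq_ker :
    idealOfVars σ F = RingHom.ker (constantCoeff : MvPolynomial σ F →+* F) := by
  ext p
  rw [mem_idealOfVars_iff, RingHom.mem_ker]

instance isMaximal_idealOfVars : (idealOfVars σ F).IsMaximal := by
  rw [idealOfVars_eq_ker]
  exact RingHom.ker_isMaximal_of_surjective _ fun c => ⟨C c, constantCoeff_C _ c⟩

theorem forall_mem_idealOfVars_mul_mem_iff {J : Ideal (MvPolynomial σ F)}
    {z : MvPolynomial σ F} :
    (∀ x ∈ idealOfVars σ F, x * z ∈ J) ↔ ∀ i, X i * z ∈ J := by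
  refine ⟨fun h i => h _ (Ideal.subset_span ⟨i, rfl⟩), fun h x hx => ?_⟩
  have hle : idealOfVars σ F ≤
      Submodule.comap (LinearMap.mulRight (MvPolynomial σ F) z) J := by
    rw [Ideal.span_le]
    rintro _ ⟨i, rfl⟩
    exact h i
  exact hle hx

attribute [local instance] weightedGradedAlgebra

/-- The ideal is homogeneous for the weights `w`. -/
def IsWeightedHomogeneousIdeal (w : σ → ℕ) (J : Ideal (MvPolynomial σ F)) : Prop :=
  J.IsHomogeneous (weightedHomogeneousSubmodule F w)

theorem degree_le_weight {w : σ → ℕ} (hw : ∀ i, w i ≠ 0) (d : σ →₀ ℕ) :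
    d.degree ≤ Finsupp.weight w d := by
  rw [Finsupp.degree_apply, Finsupp.weight_apply, Finsupp.sum]
  exact Finset.sum_le_sum fun i _ => Nat.le_mul_of_pos_right _ (Nat.pos_of_ne_zero (hw i))

theorem isWeightedHomogeneousIdeal_span {w : σ → ℕ} {s : Set (MvPolynomial σ F)}
    (h : ∀ p ∈ s, ∃ n, IsWeightedHomogeneous w p n) :
    IsWeightedHomogeneousIdeal w (Ideal.span s) :=
  Ideal.homogeneous_span _ _ fun p hp => h p hp

theorem IsWeightedHomogeneousIdeal.sup {w : σ → ℕ} {I J : Ideal (MvPolynomial σ F)}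
    (hI : IsWeightedHomogeneousIdeal w I) (hJ : IsWeightedHomogeneousIdeal w J) :
    IsWeightedHomogeneousIdeal w (I ⊔ J) :=
  Ideal.IsHomogeneous.sup hI hJ

/-- A graded form of Krull's intersection argument. Normalizing s to 1 - t with t in the ideal 𝔪 of
the variables, s z ∈ J gives z ≡ t z, hence z ∈ J + 𝔪^k for all k. Positive weights make the
component of weight n of 𝔪^(n+1) zero, so every component of z lies in J. -/
theorem IsWeightedHomogeneousIdeal.isSaturatedAt {w : σ → ℕ} (hw : ∀ i, w i ≠ 0)
    {J : Ideal (MvPolynomial σ F)} (hJ : IsWeightedHomogeneousIdeal w J) :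
    Ideal.IsSaturatedAt (idealOfVars σ F) J := by
  intro s hs z hz
  rw [mem_idealOfVars_iff] at hs
  set t : MvPolynomial σ F := 1 - C (constantCoeff s)⁻¹ * s with ht
  have htm : t ∈ idealOfVars σ F := by
    rw [mem_idealOfVars_iff, ht]
    simp [hs]
  have hzt : z - t * z ∈ J := by
    have : z - t * z = C (constantCoeff s)⁻¹ * (s * z) := by rw [ht]; ring
    rw [this]
    exact J.mul_mem_left _ hz
  have hpow : ∀ k, z ∈ J ⊔ idealOfVars σ F ^ k := by
    intro k
    induction k with
    | zero => simp
    | succ k ih =>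
      obtain ⟨j, hj, y, hy, hjy⟩ := Submodule.mem_sup.1 ih
      have : z = ((z - t * z) + t * j) + t * y := by linear_combination -t * hjy
      rw [this]
      refine Submodule.add_mem_sup (J.add_mem hzt (J.mul_mem_left _ hj)) ?_
      rw [pow_succ']
      exact Ideal.mul_mem_mul htm hy
  rw [mem_iff_weightedHomogeneousComponent_mem F w hJ]
  intro n
  obtain ⟨j, hj, y, hy, hjy⟩ := Submodule.mem_sup.1 (hpow (n + 1))
  have hy0 : weightedHomogeneousComponent w n y = 0 := by
    refine weightedHomogeneousComponent_eq_zero' n y fun d hd => ?_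
    have h1 := (mem_pow_idealOfVars_iff (n + 1) y).1 hy d hd
    have h2 : d.degree ≤ Finsupp.weight w d := degree_le_weight hw d
    omega
  rw [← hjy, map_add, hy0, add_zero]
  exact weightedHomogeneousComponent_mem_of_mem F w hJ hj n

theorem isSaturatedAt_sup_ofList_take {w : σ → ℕ} (hw : ∀ i, w i ≠ 0)
    {I : Ideal (MvPolynomial σ F)} (hI : IsWeightedHomogeneousIdeal w I)
    {l : List (MvPolynomial σ F)} (hl : ∀ p ∈ l, ∃ n, IsWeightedHomogeneous w p n) (i : ℕ) :
    Ideal.IsSaturatedAt (idealOfVars σ F) (I ⊔ Ideal.ofList (l.take i)) :=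
  (hI.sup (isWeightedHomogeneousIdeal_span
    fun p hp => hl p (List.mem_of_mem_take hp))).isSaturatedAt hw

end MvPolynomial

/-! ### Stanley-Reisner ideals of stars and links -/

namespace PreAbstractSimplicialComplex

open MvPolynomial

section Faces

variable {V : Type*} {K : PreAbstractSimplicialComplex V}

theorem isFace_empty (K : PreAbstractSimplicialComplex V) : K.IsFace ∅ := Or.inl rfl

theorem IsFace.mono {σ τ : Finset V} (hσ : K.IsFace σ) (h : τ ⊆ σ) : K.IsFace τ := by
  rcases τ.eq_empty_or_nonempty with rfl | hne
  · exact K.isFace_empty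
  · rcases hσ with rfl | hσ
    · exact absurd (Finset.subset_empty.1 h) hne.ne_empty
    · exact Or.inr ((K.isRelLowerSet_faces hσ).2 h hne)

theorem ext_isFace {K L : PreAbstractSimplicialComplex V} (h : ∀ ρ, K.IsFace ρ ↔ L.IsFace ρ) :
    K = L := by
  refine SetLike.ext fun ρ => ?_
  have hK : ρ ∈ K → ρ.Nonempty := fun hρ => (K.isRelLowerSet_faces hρ).1
  have hL : ρ ∈ L → ρ.Nonempty := fun hρ => (L.isRelLowerSet_faces hρ).1
  have := h ρ
  simp only [IsFace] at this
  rcases ρ.eq_empty_or_nonempty with rfl | hne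
  · exact ⟨fun hh => absurd (hK hh) (by simp), fun hh => absurd (hL hh) (by simp)⟩
  · simpa [hne.ne_empty] using this

variable [DecidableEq V]

/-- The star of the vertex `v`. -/
def star (K : PreAbstractSimplicialComplex V) (v : V) : PreAbstractSimplicialComplex V where
  faces := {ρ | ρ.Nonempty ∧ K.IsFace (insert v ρ)}
  isRelLowerSet_faces := fun _ hρ =>
    ⟨hρ.1, fun _ ht htne => ⟨htne, hρ.2.mono (Finset.insert_subset_insert v ht)⟩⟩

theorem isFace_star {v : V} (hv : K.IsFace {v}) {ρ : Finset V} :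
    (K.star v).IsFace ρ ↔ K.IsFace (insert v ρ) := by
  rcases ρ.eq_empty_or_nonempty with rfl | hne
  · simpa [isFace_empty] using hv
  · constructor
    · rintro (rfl | h)
      · exact absurd rfl hne.ne_empty
      · exact h.2
    · exact fun h => Or.inr ⟨hne, h⟩

theorem isFace_link {τ : Finset V} (hτ : K.IsFace τ) {ρ : Finset V} :
    (K.link τ).IsFace ρ ↔ Disjoint τ ρ ∧ K.IsFace (τ ∪ ρ) := by
  rcases ρ.eq_empty_or_nonempty with rfl | hne
  · simpa [isFace_empty] using hτ
  · constructor
    · rintro (rfl | ⟨-, t, ht, hsub, rfl⟩)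
      · exact absurd rfl hne.ne_empty
      · exact ⟨Finset.disjoint_sdiff, by rwa [Finset.union_sdiff_of_subset hsub]⟩
    · rintro ⟨hd, h⟩
      exact Or.inr ⟨hne, _, h, Finset.subset_union_left,
        (Finset.union_sdiff_cancel_left hd).symm⟩

theorem isFace_link_singleton {v : V} (hv : K.IsFace {v}) {ρ : Finset V} :
    (K.link {v}).IsFace ρ ↔ v ∉ ρ ∧ K.IsFace (insert v ρ) := by
  rw [isFace_link hv, Finset.disjoint_singleton_left, Finset.insert_eq]

theorem link_empty (K : PreAbstractSimplicialComplex V) : K.link ∅ = K :=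
  ext_isFace fun ρ => by simp [isFace_link K.isFace_empty]

theorem link_insert {τ : Finset V} {v : V} (hv : v ∉ τ) (h : K.IsFace (insert v τ)) :
    (K.link τ).IsFace {v} ∧ K.link (insert v τ) = (K.link τ).link {v} := by
  have hτ : K.IsFace τ := h.mono (Finset.subset_insert v τ)
  have hv' : (K.link τ).IsFace {v} := by
    rw [isFace_link hτ, Finset.disjoint_singleton_right, Finset.union_comm, ← Finset.insert_eq]
    exact ⟨hv, h⟩
  refine ⟨hv', ext_isFace fun ρ => ?_⟩
  rw [isFace_link h, isFace_link_singleton hv', isFace_link hτ, Finset.disjoint_insert_left,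
    Finset.disjoint_insert_right, Finset.insert_union, Finset.union_insert]
  tauto

end Faces

section Ideals

variable {V : Type*} {K : PreAbstractSimplicialComplex V} {F : Type*} [Field F]

theorem prod_X_eq_monomial (σ : Finset V) :
    (∏ j ∈ σ, X j : MvPolynomial V F) = monomial (∑ j ∈ σ, Finsupp.single j 1) 1 := by
  rw [monomial_sum_one]
  rfl

theorem sum_single_le_iff {σ : Finset V} {d : V →₀ ℕ} :
    (∑ j ∈ σ, Finsupp.single j 1) ≤ d ↔ σ ⊆ d.support := by
  classical
  have h : ∀ i, (∑ j ∈ σ, Finsupp.single j 1 : V →₀ ℕ) i = if i ∈ σ then 1 else 0 := by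
    intro i
    simp [Finsupp.finsetSum_apply, Finsupp.single_apply]
  constructor
  · intro hle i hi
    have := hle i
    rw [h, if_pos hi] at this
    rw [Finsupp.mem_support_iff]
    omega
  · intro hsub i
    rw [h]
    split_ifs with hi
    · exact Nat.one_le_iff_ne_zero.2 (Finsupp.mem_support_iff.1 (hsub hi))
    · exact Nat.zero_le _

/-- Membership in this monomial ideal is decided monomial by monomial and sees only supports; all
later ideal computations reduce to this. -/
theorem mem_stanleyReisnerIdeal_iff {p : MvPolynomial V F} :
    p ∈ K.stanleyReisnerIdeal F ↔ ∀ d, coeff d p ≠ 0 → ¬ K.IsFace d.support := by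
  have h : {f : MvPolynomial V F | ∃ σ : Finset V, ¬ K.IsFace σ ∧ f = ∏ j ∈ σ, X j} =
      (fun s => monomial s (1 : F)) ''
        ((fun σ : Finset V => ∑ j ∈ σ, Finsupp.single j 1) '' {σ | ¬ K.IsFace σ}) := by
    ext f
    simp [prod_X_eq_monomial, eq_comm]
  rw [stanleyReisnerIdeal, h, mem_ideal_span_monomial_image]
  simp only [Set.exists_mem_image, sum_single_le_iff, mem_support_iff, Set.mem_ofPred_eq]
  refine forall₂_congr fun d _ => ⟨?_, fun hd => ⟨_, hd, subset_rfl⟩⟩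
  rintro ⟨σ, hσ, hsub⟩ hd
  exact hσ (hd.mono hsub)

theorem isWeightedHomogeneousIdeal_stanleyReisnerIdeal (w : V → ℕ) :
    IsWeightedHomogeneousIdeal w (K.stanleyReisnerIdeal F) := by
  refine isWeightedHomogeneousIdeal_span ?_
  rintro _ ⟨σ, -, rfl⟩
  rw [prod_X_eq_monomial]
  exact ⟨_, isWeightedHomogeneous_monomial w _ 1 rfl⟩

theorem stanleyReisnerIdeal_le_idealOfVars :
    K.stanleyReisnerIdeal F ≤ idealOfVars V F := by
  intro p hp
  rw [mem_idealOfVars_iff, constantCoeff_eq]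
  by_contra h
  exact mem_stanleyReisnerIdeal_iff.1 hp 0 h (by simpa using K.isFace_empty)

theorem X_mem_idealOfVars (i : V) : (X i : MvPolynomial V F) ∈ idealOfVars V F :=
  Ideal.subset_span ⟨i, rfl⟩

variable [DecidableEq V]

theorem support_single_add (v : V) (d : V →₀ ℕ) :
    (Finsupp.single v 1 + d).support = insert v d.support := by
  ext i
  by_cases h : i = v
  · subst h
    simp
  · simp [h]

theorem X_mul_mem_iff {v : V} (hv : K.IsFace {v}) {p : MvPolynomial V F} :
    X v * p ∈ K.stanleyReisnerIdeal F ↔ p ∈ (K.star v).stanleyReisnerIdeal F := by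
  simp only [mem_stanleyReisnerIdeal_iff, isFace_star hv]
  constructor
  · intro h d hd
    rw [← support_single_add]
    exact h _ (by rwa [coeff_X_mul])
  · intro h d hd
    rw [coeff_X_mul'] at hd
    split_ifs at hd with hvd
    · have := h _ hd
      rw [← support_single_add] at this
      rwa [add_tsub_cancel_of_le] at this
      rw [Finsupp.single_le_iff]
      exact Nat.one_le_iff_ne_zero.2 (Finsupp.mem_support_iff.1 hvd)
    · exact absurd rfl hd

theorem stanleyReisnerIdeal_le_star {v : V} (hv : K.IsFace {v}) :
    K.stanleyReisnerIdeal F ≤ (K.star v).stanleyReisnerIdeal F := fun _ hp =>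
  (X_mul_mem_iff hv).1 (Ideal.mul_mem_left _ _ hp)

theorem stanleyReisnerIdeal_link {v : V} (hv : K.IsFace {v}) :
    (K.link {v}).stanleyReisnerIdeal F = (K.star v).stanleyReisnerIdeal F ⊔ Ideal.span {X v} := by
  apply le_antisymm
  · refine Ideal.span_le.2 ?_
    rintro _ ⟨σ, hσ, rfl⟩
    rw [isFace_link_singleton hv] at hσ
    by_cases hvσ : v ∈ σ
    · exact Submodule.mem_sup_right (Ideal.mem_span_singleton.2 (Finset.dvd_prod_of_mem _ hvσ))
    · refine Submodule.mem_sup_left (Ideal.subset_span ⟨σ, ?_, rfl⟩)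
      rw [isFace_star hv]
      tauto
  · refine sup_le (Ideal.span_le.2 ?_) ?_
    · rintro _ ⟨σ, hσ, rfl⟩
      refine Ideal.subset_span ⟨σ, ?_, rfl⟩
      rw [isFace_star hv] at hσ
      rw [isFace_link_singleton hv]
      tauto
    · rw [Ideal.span_singleton_le_iff_mem]
      refine Ideal.subset_span ⟨{v}, ?_, by simp⟩
      rw [isFace_link_singleton hv]
      simp

end Ideals

/-! ### Squaring one variable -/

section SquareVar

variable {V : Type*} {K : PreAbstractSimplicialComplex V} {F : Type*} [Field F]

/-- Doubling the exponent of `v`. -/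
noncomputable def doubleExp (v : V) (d : V →₀ ℕ) : V →₀ ℕ :=
  d + Finsupp.single v (d v)

theorem doubleExp_self (v : V) (d : V →₀ ℕ) : doubleExp v d v = 2 * d v := by
  simp [doubleExp, two_mul]

theorem doubleExp_of_ne {v i : V} (h : i ≠ v) (d : V →₀ ℕ) : doubleExp v d i = d i := by
  simp [doubleExp, Ne.symm h]

variable [DecidableEq V]

/-- The endomorphism of the polynomial ring which squares the variable `v` and fixes the others. -/
noncomputable def squareVar (F : Type*) [Field F] (v : V) :
    MvPolynomial V F →ₐ[F] MvPolynomial V F :=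
  aeval fun i => if i = v then X i ^ 2 else X i

@[simp]
theorem squareVar_X_self (v : V) : squareVar F v (X v) = X v ^ 2 := by simp [squareVar]

theorem squareVar_X_of_ne {v i : V} (h : i ≠ v) : squareVar F v (X i) = X i := by
  simp [squareVar, h]

@[simp]
theorem squareVar_C (v : V) (c : F) : squareVar F v (C c) = C c := by
  simp [squareVar, algebraMap_eq]

theorem doubleExp_injective (v : V) : Function.Injective (doubleExp v) := by
  intro d e h
  ext i
  have := DFunLike.congr_fun h i
  by_cases hi : i = v
  · subst hi
    rw [doubleExp_self, doubleExp_self] at this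
    omega
  · rwa [doubleExp_of_ne hi, doubleExp_of_ne hi] at this

theorem support_doubleExp (v : V) (d : V →₀ ℕ) : (doubleExp v d).support = d.support := by
  ext i
  by_cases hi : i = v
  · subst hi
    simp [doubleExp_self]
  · simp [doubleExp_of_ne hi]

theorem squareVar_monomial (v : V) (d : V →₀ ℕ) (c : F) :
    squareVar F v (monomial d c) = monomial (doubleExp v d) c := by
  rw [squareVar, aeval_monomial, monomial_eq, algebraMap_eq]
  congr 1
  rw [doubleExp, Finsupp.prod_add_index' (by simp) (by intros; rw [pow_add]),
    Finsupp.prod_single_index (by simp)]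
  by_cases hv : v ∈ d.support
  · rw [Finsupp.prod, Finsupp.prod, ← Finset.mul_prod_erase _ _ hv, ← Finset.mul_prod_erase _ _ hv,
      if_pos rfl, Finset.prod_congr rfl (g := fun i => X i ^ d i)]
    · ring
    · intro i hi
      rw [if_neg (Finset.ne_of_mem_erase hi)]
  · rw [Finsupp.notMem_support_iff.1 hv, pow_zero, mul_one]
    refine Finset.prod_congr rfl fun i hi => ?_
    have : i ≠ v := by
      rintro rfl
      exact hv hi
    simp only [if_neg this]

theorem coeff_doubleExp_squareVar (v : V) (d : V →₀ ℕ) (p : MvPolynomial V F) :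
    coeff (doubleExp v d) (squareVar F v p) = coeff d p := by
  induction p using MvPolynomial.induction_on' with
  | monomial e c =>
    rw [squareVar_monomial, coeff_monomial, coeff_monomial]
    simp only [(doubleExp_injective v).eq_iff]
  | add p q hp hq => rw [map_add, coeff_add, coeff_add, hp, hq]

theorem coeff_squareVar_of_odd {v : V} {d : V →₀ ℕ} (hd : Odd (d v)) (p : MvPolynomial V F) :
    coeff d (squareVar F v p) = 0 := by
  induction p using MvPolynomial.induction_on' with
  | monomial e c =>
    rw [squareVar_monomial, coeff_monomial, if_neg]
    rintro rfl
    rw [doubleExp_self] at hd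
    exact absurd hd (by simp)
  | add p q hp hq => rw [map_add, coeff_add, hp, hq, add_zero]

theorem exists_eq_squareVar_add (v : V) (p : MvPolynomial V F) :
    ∃ p₀ p₁, p = squareVar F v p₀ + X v * squareVar F v p₁ := by
  induction p using MvPolynomial.induction_on with
  | C a => exact ⟨C a, 0, by simp⟩
  | add p q hp hq =>
    obtain ⟨p₀, p₁, rfl⟩ := hp
    obtain ⟨q₀, q₁, rfl⟩ := hq
    exact ⟨p₀ + q₀, p₁ + q₁, by rw [map_add, map_add]; ring⟩
  | mul_X p i hp =>
    obtain ⟨p₀, p₁, rfl⟩ := hp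
    by_cases hi : i = v
    · subst hi
      exact ⟨X i * p₁, p₀, by rw [map_mul, squareVar_X_self]; ring⟩
    · exact ⟨p₀ * X i, p₁ * X i, by
        rw [map_mul, map_mul, squareVar_X_of_ne hi]; ring⟩

/-- Exponents of v are even in the first summand and odd in the second, so no cancellation occurs.
Doubling an exponent keeps the support, while the extra factor `X v` inserts v into it, which turns
K into its star. -/
theorem squareVar_add_mem_iff {v : V} (hv : K.IsFace {v}) {p₀ p₁ : MvPolynomial V F} :
    squareVar F v p₀ + X v * squareVar F v p₁ ∈ K.stanleyReisnerIdeal F ↔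
      p₀ ∈ K.stanleyReisnerIdeal F ∧ p₁ ∈ (K.star v).stanleyReisnerIdeal F := by
  have hle : ∀ (L : PreAbstractSimplicialComplex V), ∀ p ∈ L.stanleyReisnerIdeal F,
      squareVar F v p ∈ L.stanleyReisnerIdeal F := by
    intro L
    change L.stanleyReisnerIdeal F ≤ (L.stanleyReisnerIdeal F).comap (squareVar F v)
    refine Ideal.span_le.2 ?_
    rintro _ ⟨σ, hσ, rfl⟩
    rw [SetLike.mem_coe, Ideal.mem_comap, map_prod]
    refine Ideal.mem_of_dvd _ (Finset.prod_dvd_prod_of_dvd (fun j => X j) _ fun i _ => ?_)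
      (Ideal.subset_span ⟨σ, hσ, rfl⟩)
    by_cases hi : i = v
    · subst hi
      rw [squareVar_X_self]
      exact dvd_pow_self _ two_ne_zero
    · rw [squareVar_X_of_ne hi]
  refine ⟨fun h => ?_, fun h =>
    Ideal.add_mem _ (hle K _ h.1) ((X_mul_mem_iff hv).2 (hle _ _ h.2))⟩
  rw [mem_stanleyReisnerIdeal_iff] at h
  have hodd : ∀ d : V →₀ ℕ, Odd ((Finsupp.single v 1 + doubleExp v d : V →₀ ℕ) v) := fun d => by
    rw [Finsupp.add_apply, Finsupp.single_eq_same, doubleExp_self, add_comm]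
    exact odd_two_mul_add_one _
  constructor
  · rw [mem_stanleyReisnerIdeal_iff]
    intro d hd
    have := h (doubleExp v d) ?_
    · rwa [support_doubleExp] at this
    · rw [coeff_add, coeff_doubleExp_squareVar, coeff_X_mul']
      split_ifs with hvd
      · rw [coeff_squareVar_of_odd, add_zero]
        · exact hd
        · rw [support_doubleExp, Finsupp.mem_support_iff] at hvd
          rw [Finsupp.tsub_apply, Finsupp.single_eq_same, doubleExp_self]
          exact ⟨d v - 1, by omega⟩
      · rwa [add_zero]
  · rw [mem_stanleyReisnerIdeal_iff]
    intro d hd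
    have := h (Finsupp.single v 1 + doubleExp v d) ?_
    · rwa [support_single_add, support_doubleExp, ← isFace_star hv] at this
    · rwa [coeff_add, coeff_squareVar_of_odd (hodd d), zero_add, coeff_X_mul,
        coeff_doubleExp_squareVar]

/-- The splitting of R/(I_K + φ(J)R) into R/(I_K + J) and R/(I_st + J). -/
theorem squareVar_add_mem_sup_map_iff {v : V} (hv : K.IsFace {v}) {J : Ideal (MvPolynomial V F)}
    {p₀ p₁ : MvPolynomial V F} :
    squareVar F v p₀ + X v * squareVar F v p₁ ∈
        K.stanleyReisnerIdeal F ⊔ J.map (squareVar F v) ↔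
      p₀ ∈ K.stanleyReisnerIdeal F ⊔ J ∧ p₁ ∈ (K.star v).stanleyReisnerIdeal F ⊔ J := by
  constructor
  · intro h
    obtain ⟨k, hk, y, hy, hky⟩ := Submodule.mem_sup.1 h
    -- The extended ideal is φ(J) + vφ(J): stability under multiplication by v comes from v² = φ(v).
    have hy' : ∃ j₀ ∈ J, ∃ j₁ ∈ J, y = squareVar F v j₀ + X v * squareVar F v j₁ := by
      clear hky
      refine Submodule.span_induction ?_ ?_ ?_ ?_ hy
      · rintro _ ⟨j, hj, rfl⟩
        exact ⟨j, hj, 0, J.zero_mem, by simp⟩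
      · exact ⟨0, J.zero_mem, 0, J.zero_mem, by simp⟩
      · rintro _ _ - - ⟨j₀, h₀, j₁, h₁, rfl⟩ ⟨i₀, g₀, i₁, g₁, rfl⟩
        exact ⟨j₀ + i₀, J.add_mem h₀ g₀, j₁ + i₁, J.add_mem h₁ g₁, by
          rw [map_add, map_add]; ring⟩
      · rintro a _ - ⟨j₀, h₀, j₁, h₁, rfl⟩
        obtain ⟨a₀, a₁, rfl⟩ := exists_eq_squareVar_add v a
        refine ⟨a₀ * j₀ + X v * (a₁ * j₁), J.add_mem (J.mul_mem_left _ h₀)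
          (J.mul_mem_left _ (J.mul_mem_left _ h₁)), a₀ * j₁ + a₁ * j₀,
          J.add_mem (J.mul_mem_left _ h₁) (J.mul_mem_left _ h₀), ?_⟩
        simp only [map_add, map_mul, squareVar_X_self, smul_eq_mul]
        ring
    obtain ⟨j₀, h₀, j₁, h₁, rfl⟩ := hy'
    have hk' : squareVar F v (p₀ - j₀) + X v * squareVar F v (p₁ - j₁) ∈
        K.stanleyReisnerIdeal F := by
      convert hk using 1
      rw [map_sub, map_sub]
      linear_combination -hky
    obtain ⟨h2, h3⟩ := (squareVar_add_mem_iff hv).1 hk'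
    exact ⟨by simpa using Submodule.add_mem_sup h2 h₀, by simpa using Submodule.add_mem_sup h3 h₁⟩
  · rintro ⟨h₀, h₁⟩
    obtain ⟨i, hi, j, hj, rfl⟩ := Submodule.mem_sup.1 h₀
    obtain ⟨i', hi', j', hj', rfl⟩ := Submodule.mem_sup.1 h₁
    have h1 := (squareVar_add_mem_iff hv).2 ⟨hi, hi'⟩
    have h2 : squareVar F v j + X v * squareVar F v j' ∈ J.map (squareVar F v) :=
      Ideal.add_mem _ (Ideal.mem_map_of_mem _ hj)
        (Ideal.mul_mem_left _ _ (Ideal.mem_map_of_mem _ hj'))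
    convert Submodule.add_mem_sup h1 h2 using 1
    rw [map_add, map_add]
    ring

theorem squareVar_mem_sup_map_iff {v : V} (hv : K.IsFace {v}) {J : Ideal (MvPolynomial V F)}
    {p : MvPolynomial V F} :
    squareVar F v p ∈ K.stanleyReisnerIdeal F ⊔ J.map (squareVar F v) ↔
      p ∈ K.stanleyReisnerIdeal F ⊔ J := by
  have := squareVar_add_mem_sup_map_iff hv (J := J) (p₀ := p) (p₁ := 0)
  simpa using this

theorem X_mul_squareVar_mem_sup_map_iff {v : V} (hv : K.IsFace {v})
    {J : Ideal (MvPolynomial V F)} {p : MvPolynomial V F} :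
    X v * squareVar F v p ∈ K.stanleyReisnerIdeal F ⊔ J.map (squareVar F v) ↔
      p ∈ (K.star v).stanleyReisnerIdeal F ⊔ J := by
  have := squareVar_add_mem_sup_map_iff hv (J := J) (p₀ := 0) (p₁ := p)
  simpa using this

theorem isRegularSeqMod_star_of_map_squareVar {v : V} (hv : K.IsFace {v})
    {J : Ideal (MvPolynomial V F)} {l : List (MvPolynomial V F)}
    (h : (K.stanleyReisnerIdeal F ⊔ J.map (squareVar F v)).IsRegularSeqMod
      (l.map (squareVar F v))) :
    ((K.star v).stanleyReisnerIdeal F ⊔ J).IsRegularSeqMod l := by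
  induction l generalizing J with
  | nil => trivial
  | cons a l ih =>
    refine ⟨fun z hz => ?_, ?_⟩
    · rw [← X_mul_squareVar_mem_sup_map_iff hv] at hz ⊢
      refine h.1 _ ?_
      rwa [map_mul, mul_left_comm] at hz
    · have h2 := h.2
      rw [sup_assoc, ← Set.image_singleton, ← Ideal.map_span, ← Ideal.map_sup] at h2
      rw [sup_assoc]
      exact ih h2

theorem squareVar_mem_idealOfVars {v : V} {p : MvPolynomial V F} (hp : p ∈ idealOfVars V F) :
    squareVar F v p ∈ idealOfVars V F := by
  have hle : idealOfVars V F ≤ (idealOfVars V F).comap (squareVar F v) := by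
    refine Ideal.span_le.2 ?_
    rintro _ ⟨i, rfl⟩
    rw [SetLike.mem_coe, Ideal.mem_comap]
    by_cases hi : i = v
    · subst hi
      rw [squareVar_X_self]
      exact Ideal.pow_mem_of_mem _ (X_mem_idealOfVars _) 2 two_pos
    · rw [squareVar_X_of_ne hi]
      exact X_mem_idealOfVars _
  exact hle hp

theorem weight_doubleExp (v : V) (d : V →₀ ℕ) :
    Finsupp.weight (fun i => if i = v then 1 else 2) (doubleExp v d) =
      Finsupp.weight (fun _ => 2) d := by
  rw [doubleExp, map_add, Finsupp.weight_single, if_pos rfl]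
  simp only [Finsupp.weight_apply, Finsupp.sum, smul_eq_mul, mul_one]
  by_cases hv : v ∈ d.support
  · rw [← Finset.add_sum_erase _ _ hv, ← Finset.add_sum_erase _ _ hv, if_pos rfl,
      Finset.sum_congr rfl (g := fun i => d i * 2)]
    · ring
    · intro i hi
      rw [if_neg (Finset.ne_of_mem_erase hi)]
  · rw [Finsupp.notMem_support_iff.1 hv, add_zero]
    refine Finset.sum_congr rfl fun i hi => ?_
    have : i ≠ v := by
      rintro rfl
      exact hv hi
    rw [if_neg this]

/-- Giving v half its weight compensates for the squaring. Some positive grading must survive, so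
that the ideals generated by the images remain saturated. -/
theorem isWeightedHomogeneous_squareVar {v : V} {p : MvPolynomial V F} {n : ℕ}
    (hp : IsWeightedHomogeneous (fun _ => 2) p n) :
    IsWeightedHomogeneous (fun i => if i = v then 1 else 2) (squareVar F v p) n := by
  rw [p.as_sum, map_sum]
  refine IsWeightedHomogeneous.sum _ _ _ fun d hd => ?_
  rw [squareVar_monomial]
  refine isWeightedHomogeneous_monomial _ _ _ ?_
  rw [weight_doubleExp]
  exact hp (mem_support_iff.1 hd)

end SquareVar

end PreAbstractSimplicialComplex

/-! ### Parameters of face rings -/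

namespace PreAbstractSimplicialComplex

open MvPolynomial

variable {V : Type*} {K : PreAbstractSimplicialComplex V} {F : Type*} [Field F]

/-- Homogeneous polynomials of positive degree that generate, together with the Stanley-Reisner
ideal, an ideal primary to the ideal of the variables. -/
structure IsParameterList (K : PreAbstractSimplicialComplex V) (l : List (MvPolynomial V F)) :
    Prop where
  mem : ∀ p ∈ l, p ∈ idealOfVars V F
  homogeneous : ∀ p ∈ l, ∃ n, IsWeightedHomogeneous (fun _ => 2) p n
  le_radical : idealOfVars V F ≤ (K.stanleyReisnerIdeal F ⊔ Ideal.ofList l).radical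

theorem stanleyReisnerIdeal_sup_ofList_le {l : List (MvPolynomial V F)}
    (hl : K.IsParameterList l) :
    K.stanleyReisnerIdeal F ⊔ Ideal.ofList l ≤ idealOfVars V F :=
  sup_le stanleyReisnerIdeal_le_idealOfVars (Ideal.span_le.2 fun p hp => hl.mem p hp)

theorem idealOfVars_le_radical_of_forall_X {J : Ideal (MvPolynomial V F)}
    (h : ∀ i, X i ∈ J.radical) : idealOfVars V F ≤ J.radical :=
  Ideal.span_le.2 (by rintro _ ⟨i, rfl⟩; exact h i)

/-- Multiplying by `X i` does not affect the exponents of the variables in S, and only those decide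
membership. -/
theorem isRegularSeqMod_map_X {S : Set V} {t : List V} (hnd : t.Nodup) (hS : ∀ i ∈ t, i ∉ S) :
    (Ideal.span (X '' S) : Ideal (MvPolynomial V F)).IsRegularSeqMod (t.map X) := by
  induction t generalizing S with
  | nil => trivial
  | cons i t ih =>
    rw [List.nodup_cons] at hnd
    refine ⟨fun z hz => ?_, ?_⟩
    · rw [mem_ideal_span_X_image] at hz ⊢
      intro d hd
      obtain ⟨j, hj, hjd⟩ := hz (Finsupp.single i 1 + d) (by
        rw [mem_support_iff, coeff_X_mul]
        exact mem_support_iff.1 hd)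
      have hne : i ≠ j := by
        rintro rfl
        exact hS i (by simp) hj
      exact ⟨j, hj, by simpa [Finsupp.single_apply, hne] using hjd⟩
    · have := ih (S := insert i S) hnd.2 (by
        intro j hj hjS
        rcases hjS with rfl | hjS
        · exact hnd.1 hj
        · exact hS j (by simp [hj]) hjS)
      rwa [Set.image_insert_eq, Set.insert_eq, Ideal.span_union, sup_comm] at this

/-- I_K lies in the ideal of the variables outside σ. Modulo that ideal the variables of σ form a
regular sequence, while l still generates an ideal with radical containing all variables, so the
length bound applies. -/
theorem IsFace.card_le [Finite V] {σ : Finset V} (hσ : K.IsFace σ) {l : List (MvPolynomial V F)}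
    (hl : K.IsParameterList l) : σ.card ≤ l.length := by
  classical
  have hle : K.stanleyReisnerIdeal F ≤ Ideal.span (X '' (σ : Set V)ᶜ) := by
    refine Ideal.span_le.2 ?_
    rintro _ ⟨τ, hτ, rfl⟩
    obtain ⟨j, hj, hjσ⟩ := Finset.not_subset.1 fun h => hτ (hσ.mono h)
    exact Ideal.mem_of_dvd _ (Finset.dvd_prod_of_mem _ hj)
      (Ideal.subset_span ⟨j, by simpa using hjσ, rfl⟩)
  have hreg := isRegularSeqMod_map_X (F := F) (S := (σ : Set V)ᶜ) σ.nodup_toList (by simp)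
  have := hreg.length_le_of_le_radical (𝔪 := idealOfVars V F) (bs := l)
    (Ideal.span_mono (Set.image_subset_range _ _)) (by
      intro a ha
      obtain ⟨i, -, rfl⟩ := List.mem_map.1 ha
      exact X_mem_idealOfVars i) hl.mem
    (hl.le_radical.trans (Ideal.radical_mono (sup_le_sup_right hle _)))
  simpa using this

/-! ### From a complex to the star and the link of a vertex -/

section Vertex

variable [DecidableEq V] {v : V} {l b : List (MvPolynomial V F)}

theorem ofList_map_squareVar (v : V) (l : List (MvPolynomial V F)) :
    Ideal.ofList (l.map (squareVar F v)) = (Ideal.ofList l).map (squareVar F v) :=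
  (Ideal.map_ofList (squareVar F v).toRingHom l).symm

theorem idealOfVars_le_radical_map_squareVar (hv : K.IsFace {v}) (hl : K.IsParameterList l) :
    idealOfVars V F ≤
      (K.stanleyReisnerIdeal F ⊔ Ideal.ofList (l.map (squareVar F v))).radical := by
  rw [ofList_map_squareVar]
  refine idealOfVars_le_radical_of_forall_X fun i => ?_
  obtain ⟨n, hn⟩ := hl.le_radical (X_mem_idealOfVars i)
  have hn' := (squareVar_mem_sup_map_iff hv).2 hn
  rw [map_pow] at hn'
  by_cases hi : i = v
  · subst hi
    rw [squareVar_X_self, ← pow_mul] at hn'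
    exact ⟨_, hn'⟩
  · rw [squareVar_X_of_ne hi] at hn'
    exact ⟨_, hn'⟩

theorem IsParameterList.star (hv : K.IsFace {v}) (hl : K.IsParameterList l) :
    (K.star v).IsParameterList l where
  mem := hl.mem
  homogeneous := hl.homogeneous
  le_radical := hl.le_radical.trans
    (Ideal.radical_mono (sup_le_sup_right (stanleyReisnerIdeal_le_star hv) _))

theorem IsParameterList.cons_link (hv : K.IsFace {v}) (hb : (K.link {v}).IsParameterList b) :
    (K.star v).IsParameterList (X v :: b) where
  mem := by
    simp only [List.mem_cons, forall_eq_or_imp]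
    exact ⟨X_mem_idealOfVars v, hb.mem⟩
  homogeneous := by
    simp only [List.mem_cons, forall_eq_or_imp]
    exact ⟨⟨2, isWeightedHomogeneous_X F _ v⟩, hb.homogeneous⟩
  le_radical := by
    rw [Ideal.sup_ofList_cons, ← stanleyReisnerIdeal_link hv]
    exact hb.le_radical

variable [Finite V]

/-- The images under `squareVar` are parameters of K of the same length, hence regular; their action
on the summand vφ(R) is that of l on the star. -/
theorem isRegularSeqMod_star (hv : K.IsFace {v}) (hl : K.IsParameterList l)
    (hreg : (K.stanleyReisnerIdeal F).IsRegularSeqMod l) :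
    ((K.star v).stanleyReisnerIdeal F).IsRegularSeqMod l := by
  have hmap : (K.stanleyReisnerIdeal F).IsRegularSeqMod (l.map (squareVar F v)) := by
    refine hreg.exchange_of_isSaturatedAt (𝔪 := idealOfVars V F) (by simp) hl.mem ?_
      (idealOfVars_le_radical_map_squareVar hv hl)
      (isSaturatedAt_sup_ofList_take (w := fun i => if i = v then 1 else 2)
        (by intro i; split_ifs <;> simp)
        (isWeightedHomogeneousIdeal_stanleyReisnerIdeal _) ?_)
    · intro p hp
      obtain ⟨q, hq, rfl⟩ := List.mem_map.1 hp
      exact squareVar_mem_idealOfVars (hl.mem q hq)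
    · intro p hp
      obtain ⟨q, hq, rfl⟩ := List.mem_map.1 hp
      obtain ⟨n, hn⟩ := hl.homogeneous q hq
      exact ⟨n, isWeightedHomogeneous_squareVar hn⟩
  have := isRegularSeqMod_star_of_map_squareVar hv (J := ⊥) (l := l) (F := F) (by
    rwa [Ideal.map_bot, sup_bot_eq])
  rwa [sup_bot_eq] at this

theorem isRegularSeqMod_link (hv : K.IsFace {v}) (hl : K.IsParameterList l)
    (hreg : (K.stanleyReisnerIdeal F).IsRegularSeqMod l)
    (hb : (K.link {v}).IsParameterList b) (hlen : l.length = b.length + 1) :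
    ((K.link {v}).stanleyReisnerIdeal F).IsRegularSeqMod b := by
  have hb' := hb.cons_link hv
  have := (isRegularSeqMod_star hv hl hreg).exchange_of_isSaturatedAt (𝔪 := idealOfVars V F)
    (bs := X v :: b) (by simpa using hlen) hl.mem hb'.mem hb'.le_radical
    (isSaturatedAt_sup_ofList_take (w := fun _ => 2) (by simp)
      (isWeightedHomogeneousIdeal_stanleyReisnerIdeal _) hb'.homogeneous)
  rw [stanleyReisnerIdeal_link hv]
  exact this.2

theorem length_le_of_link (hv : K.IsFace {v}) (hl : K.IsParameterList l)
    (hreg : (K.stanleyReisnerIdeal F).IsRegularSeqMod l)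
    (hb : (K.link {v}).IsParameterList b) : l.length ≤ b.length + 1 := by
  have hb' := hb.cons_link hv
  simpa using (isRegularSeqMod_star hv hl hreg).length_le_of_le_radical (bs := X v :: b)
    stanleyReisnerIdeal_le_idealOfVars hl.mem hb'.mem hb'.le_radical

/-- If the socles modulo `l` and modulo its image under `squareVar` are one-dimensional for `K`,
then so is the socle modulo `l` for the star. -/
theorem hasCyclicSocle_star_of_squareVar (hv : K.IsFace {v}) (hl : K.IsParameterList l)
    (h : Ideal.HasCyclicSocle (C : F → MvPolynomial V F) (idealOfVars V F)
      (K.stanleyReisnerIdeal F ⊔ Ideal.ofList l))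
    (h' : Ideal.HasCyclicSocle (C : F → MvPolynomial V F) (idealOfVars V F)
      (K.stanleyReisnerIdeal F ⊔ Ideal.ofList (l.map (squareVar F v)))) :
    Ideal.HasCyclicSocle (C : F → MvPolynomial V F) (idealOfVars V F)
      ((K.star v).stanleyReisnerIdeal F ⊔ Ideal.ofList l) := by
  rw [ofList_map_squareVar] at h'
  set J := Ideal.ofList l
  set A := K.stanleyReisnerIdeal F ⊔ J with hA
  set B := (K.star v).stanleyReisnerIdeal F ⊔ J with hB
  set D := K.stanleyReisnerIdeal F ⊔ J.map (squareVar F v) with hD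
  have hsq : ∀ {p}, squareVar F v p ∈ D ↔ p ∈ A := squareVar_mem_sup_map_iff hv
  have hXsq : ∀ {p}, X v * squareVar F v p ∈ D ↔ p ∈ B := X_mul_squareVar_mem_sup_map_iff hv
  have hsum : ∀ {p q}, squareVar F v p + X v * squareVar F v q ∈ D ↔ p ∈ A ∧ q ∈ B :=
    squareVar_add_mem_sup_map_iff hv
  have hAB : A ≤ B := sup_le_sup_right (stanleyReisnerIdeal_le_star hv) _
  have hXB : ∀ p ∈ B, X v * p ∈ A := by
    intro p hp
    obtain ⟨i, hi, j, hj, rfl⟩ := Submodule.mem_sup.1 hp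
    rw [mul_add]
    exact Submodule.add_mem_sup ((X_mul_mem_iff hv).2 hi) (J.mul_mem_left _ hj)
  -- If B = A, the hypothesis on K is the claim. Otherwise B/A contains a socle element u modulo A,
  -- and u ∈ B makes v kill φ(u) modulo D.
  by_cases hBA : B ≤ A
  · rwa [le_antisymm hBA hAB]
  obtain ⟨u, huB, huA, hmu⟩ :=
    Ideal.exists_mem_socle (idealOfVars_fg V F) hl.le_radical hBA
  rw [forall_mem_idealOfVars_mul_mem_iff] at hmu
  obtain ⟨g, -, -, hg⟩ := h
  obtain ⟨g', -, -, hg'⟩ := h'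
  have hscalar : ∀ {c : F} {p} {I : Ideal (MvPolynomial V F)}, C c * p ∈ I → c ≠ 0 → p ∈ I := by
    intro c p I hp hc
    have := I.mul_mem_left (C c⁻¹) hp
    rwa [← mul_assoc, ← C_mul, inv_mul_cancel₀ hc, C_1, one_mul] at this
  -- the image of `u` spans the socle modulo `D`
  have husoc : ∀ x ∈ idealOfVars V F, x * squareVar F v u ∈ D := by
    rw [forall_mem_idealOfVars_mul_mem_iff]
    intro i
    by_cases hi : i = v
    · subst hi
      exact hXsq.2 huB
    · have := hsq.2 (hmu i)
      rwa [map_mul, squareVar_X_of_ne hi] at this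
  obtain ⟨cu, hcu⟩ := hg' _ husoc
  -- For such b, vφ(b) is a socle element modulo D, hence linearly dependent on φ(u), which is
  -- nonzero there. As these lie in different summands, vφ(b) must vanish modulo D.
  have hinj : ∀ b, (∀ i, X i * b ∈ B) → X v * b ∈ A → b ∈ B := by
    intro b hb hvb
    have hbsoc : ∀ x ∈ idealOfVars V F, x * (X v * squareVar F v b) ∈ D := by
      rw [forall_mem_idealOfVars_mul_mem_iff]
      intro i
      by_cases hi : i = v
      · subst hi
        have := hsq.2 hvb
        rwa [map_mul, squareVar_X_self, pow_two, mul_assoc] at this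
      · have := hXsq.2 (hb i)
        rwa [map_mul, squareVar_X_of_ne hi, mul_left_comm] at this
    obtain ⟨cb, hcb⟩ := hg' _ hbsoc
    have hcomb : squareVar F v (C (-cb) * u) + X v * squareVar F v (C cu * b) ∈ D := by
      have := D.sub_mem (D.mul_mem_left (C cu) hcb) (D.mul_mem_left (C cb) hcu)
      convert this using 1
      simp only [map_mul, squareVar_C, map_neg]
      ring
    obtain ⟨-, h2⟩ := hsum.1 hcomb
    by_cases hcu0 : cu = 0
    · rw [hcu0, C_0, zero_mul, sub_zero] at hcu
      exact absurd (hsq.1 hcu) huA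
    · exact hscalar h2 hcu0
  -- multiplication by `X v` embeds the socle modulo `B` into the socle modulo `A`
  have hXsoc : ∀ b, (∀ i, X i * b ∈ B) → ∀ x ∈ idealOfVars V F, x * (X v * b) ∈ A := by
    intro b hb
    rw [forall_mem_idealOfVars_mul_mem_iff]
    intro i
    rw [mul_left_comm]
    exact hXB _ (hb i)
  have hlB := hl.star hv
  obtain ⟨s, hsB, hs⟩ := Ideal.hasSocle_of_le_radical (idealOfVars_fg V F) hlB.le_radical
    (ne_top_of_le_ne_top isMaximal_idealOfVars.ne_top (stanleyReisnerIdeal_sup_ofList_le hlB))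
  refine ⟨s, hsB, hs, fun z hz => ?_⟩
  rw [forall_mem_idealOfVars_mul_mem_iff] at hs hz
  obtain ⟨cs, hcs⟩ := hg _ (hXsoc s hs)
  obtain ⟨cz, hcz⟩ := hg _ (hXsoc z hz)
  have hcs0 : cs ≠ 0 := by
    rintro rfl
    rw [C_0, zero_mul, sub_zero] at hcs
    exact hsB (hinj s hs hcs)
  refine ⟨cs⁻¹ * cz, hinj _ (fun i => ?_) ?_⟩
  · have : X i * (z - C (cs⁻¹ * cz) * s) = X i * z - C (cs⁻¹ * cz) * (X i * s) := by ring
    rw [this]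
    exact B.sub_mem (hz i) (B.mul_mem_left _ (hs i))
  · have hC : (C cs⁻¹ * C cs : MvPolynomial V F) = 1 := by
      rw [← C_mul, inv_mul_cancel₀ hcs0, C_1]
    have : X v * (z - C (cs⁻¹ * cz) * s) =
        (X v * z - C cz * g) - C (cs⁻¹ * cz) * (X v * s - C cs * g) := by
      rw [C_mul]
      linear_combination (-C cz * g) * hC
    rw [this]
    exact A.sub_mem hcz (A.mul_mem_left _ hcs)

theorem hasCyclicSocle_link (hv : K.IsFace {v}) (hl : K.IsParameterList l)
    (hreg : (K.stanleyReisnerIdeal F).IsRegularSeqMod l)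
    (hb : (K.link {v}).IsParameterList b) (hlen : l.length = b.length + 1)
    (h : Ideal.HasCyclicSocle (C : F → MvPolynomial V F) (idealOfVars V F)
      (K.stanleyReisnerIdeal F ⊔ Ideal.ofList l)) :
    Ideal.HasCyclicSocle (C : F → MvPolynomial V F) (idealOfVars V F)
      ((K.link {v}).stanleyReisnerIdeal F ⊔ Ideal.ofList b) := by
  have hsq := hreg.hasCyclicSocle_exchange (bs := l.map (squareVar F v)) (by simp) hl.mem (by
    intro p hp
    obtain ⟨q, hq, rfl⟩ := List.mem_map.1 hp
    exact squareVar_mem_idealOfVars (hl.mem q hq)) hl.le_radical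
    (idealOfVars_le_radical_map_squareVar hv hl) h
  have hb' := hb.cons_link hv
  have := (isRegularSeqMod_star hv hl hreg).hasCyclicSocle_exchange (bs := X v :: b)
    (by simpa using hlen) hl.mem hb'.mem (hl.star hv).le_radical hb'.le_radical
    (hasCyclicSocle_star_of_squareVar hv hl h hsq)
  rwa [Ideal.sup_ofList_cons, ← stanleyReisnerIdeal_link hv] at this

end Vertex

end PreAbstractSimplicialComplex

/-! ### Elementary symmetric polynomials as parameters -/

namespace PreAbstractSimplicialComplex

open MvPolynomial

variable {V : Type*} {K : PreAbstractSimplicialComplex V} {F : Type*} [Field F]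

section Esymm

variable [Fintype V]

theorem esymm_mem_stanleyReisnerIdeal {n j : ℕ} (hK : ∀ σ, K.IsFace σ → σ.card ≤ n) (hj : n < j) :
    esymm V F j ∈ K.stanleyReisnerIdeal F := by
  refine Ideal.sum_mem _ fun t ht => Ideal.subset_span ⟨t, fun hface => ?_, rfl⟩
  have := hK t hface
  rw [(Finset.mem_powersetCard.1 ht).2] at this
  omega

theorem isWeightedHomogeneous_esymm (j : ℕ) :
    IsWeightedHomogeneous (fun _ : V => 2) (esymm V F j) (j * 2) := by
  refine IsWeightedHomogeneous.sum _ _ _ fun t ht => ?_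
  have := IsWeightedHomogeneous.prod t (fun i => (X i : MvPolynomial V F)) (fun _ => 2)
    (w := fun _ => 2) fun i _ => isWeightedHomogeneous_X F _ i
  rwa [Finset.sum_const, (Finset.mem_powersetCard.1 ht).2, smul_eq_mul] at this

/-- Each variable is, up to sign, a root of a monic polynomial with elementary symmetric
coefficients, so a power of it lies in the ideal they generate. Those of degree above n are sums of
non-face monomials and can be omitted. -/
theorem isParameterList_esymm {n : ℕ} (hK : ∀ σ, K.IsFace σ → σ.card ≤ n) :
    K.IsParameterList (List.ofFn fun i : Fin n => esymm V F (i + 1)) where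
  mem := by
    simp only [List.forall_mem_ofFn_iff]
    intro i
    refine Ideal.sum_mem _ fun t ht => ?_
    obtain ⟨j, hj⟩ : t.Nonempty := by
      rw [← Finset.card_pos, (Finset.mem_powersetCard.1 ht).2]
      omega
    exact Ideal.mem_of_dvd _ (Finset.dvd_prod_of_mem _ hj) (X_mem_idealOfVars j)
  homogeneous := by
    simp only [List.forall_mem_ofFn_iff]
    exact fun i => ⟨_, isWeightedHomogeneous_esymm _⟩
  le_radical := by
    set J := K.stanleyReisnerIdeal F ⊔ Ideal.ofList (List.ofFn fun i : Fin n => esymm V F (i + 1))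
    have hmem : ∀ j, esymm V F (j + 1) ∈ J := by
      intro j
      by_cases hj : j < n
      · exact Submodule.mem_sup_right (Ideal.subset_span (by
          simpa using ⟨⟨j, hj⟩, rfl⟩))
      · exact Submodule.mem_sup_left (esymm_mem_stanleyReisnerIdeal hK (by omega))
    refine idealOfVars_le_radical_of_forall_X fun i => ⟨Fintype.card V, ?_⟩
    have h := congrArg (Polynomial.eval (-X i)) (prod_C_add_X_eq_sum_esymm F V)
    rw [Polynomial.eval_prod, Finset.prod_eq_zero (Finset.mem_univ i) (by simp),
      Finset.sum_range_succ', Polynomial.eval_add] at h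
    simp only [Polynomial.eval_finsetSum, Polynomial.eval_mul, Polynomial.eval_C,
      Polynomial.eval_pow, Polynomial.eval_X, esymm_zero, one_mul, Nat.sub_zero] at h
    rw [← neg_mem_iff, ← Ideal.unit_mul_mem_iff_mem J ((isUnit_one.neg).pow (Fintype.card V))]
    have h' : (-1) ^ Fintype.card V * -(X i ^ Fintype.card V : MvPolynomial V F) =
        ∑ j ∈ Finset.range (Fintype.card V), esymm V F (j + 1) *
          (-X i) ^ (Fintype.card V - (j + 1)) := by
      rw [neg_pow] at h
      linear_combination h
    rw [h']
    exact Ideal.sum_mem _ fun j _ => J.mul_mem_right _ (hmem j)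

end Esymm

/-! ### Restriction to a face -/

section Restriction

variable [DecidableEq V]

/-- The restriction of polynomials to the coordinate subspace of `σ`. -/
noncomputable def restrictPoly (F : Type*) [Field F] (σ : Finset V) :
    MvPolynomial V F →ₐ[F] MvPolynomial σ F :=
  aeval fun i => if h : i ∈ σ then X ⟨i, h⟩ else 0

theorem restrictPoly_eq_zero {σ : Finset V} (hσ : K.IsFace σ) {p : MvPolynomial V F}
    (hp : p ∈ K.stanleyReisnerIdeal F) : restrictPoly F σ p = 0 := by
  have hle : K.stanleyReisnerIdeal F ≤ RingHom.ker (restrictPoly F σ) := by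
    refine Ideal.span_le.2 ?_
    rintro _ ⟨τ, hτ, rfl⟩
    obtain ⟨j, hj, hjσ⟩ := Finset.not_subset.1 fun h => hτ (hσ.mono h)
    rw [SetLike.mem_coe, RingHom.mem_ker, map_prod]
    exact Finset.prod_eq_zero hj (by simp [restrictPoly, hjσ])
  exact hle hp

/-- The restriction of the face ring to a face. -/
noncomputable def restrictFace {σ : Finset V} (hσ : K.IsFace σ) :
    K.FaceRing F →ₐ[F] MvPolynomial σ F :=
  Ideal.Quotient.liftₐ _ (restrictPoly F σ) fun _ hp => restrictPoly_eq_zero hσ hp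

theorem coeff_rename_restrictPoly {σ : Finset V} {d : V →₀ ℕ} (hd : d.support ⊆ σ)
    (p : MvPolynomial V F) :
    coeff d (rename Subtype.val (restrictPoly F σ p)) = coeff d p := by
  induction p using MvPolynomial.induction_on' with
  | monomial e c =>
    rw [restrictPoly, aeval_monomial, map_mul, algebraMap_eq, rename_C, Finsupp.prod, map_prod]
    by_cases he : e.support ⊆ σ
    · rw [monomial_eq, Finsupp.prod]
      congr 2
      refine Finset.prod_congr rfl fun i hi => ?_
      rw [map_pow, dif_pos (he hi), rename_X]
    · obtain ⟨i, hi, hiσ⟩ := Finset.not_subset.1 he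
      rw [Finset.prod_eq_zero hi, mul_zero, coeff_zero, coeff_monomial, if_neg]
      · rintro rfl
        exact he hd
      · rw [map_pow, dif_neg hiσ, map_zero, zero_pow (Finsupp.mem_support_iff.1 hi)]
  | add p q hp hq => rw [map_add, map_add, coeff_add, coeff_add, hp, hq]

/-- A monomial whose support is a face survives restriction to that support, so the face ring embeds
in the product of the polynomial rings of its faces. -/
theorem mem_stanleyReisnerIdeal_of_restrictPoly {p : MvPolynomial V F}
    (h : ∀ σ, K.IsFace σ → restrictPoly F σ p = 0) : p ∈ K.stanleyReisnerIdeal F := by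
  rw [mem_stanleyReisnerIdeal_iff]
  intro d hd hface
  refine hd ?_
  rw [← coeff_rename_restrictPoly subset_rfl, h _ hface, map_zero, coeff_zero]

/-- Algebraically independent families in a face ring are not longer than the largest face. -/
theorem exists_isFace_le_card [Finite V] {s : ℕ} {b : Fin s → K.FaceRing F}
    (hb : AlgebraicIndependent F b) : ∃ σ, K.IsFace σ ∧ s ≤ σ.card := by
  classical
  have := Fintype.ofFinite V
  let faces : Finset {σ : Finset V // K.IsFace σ} := Finset.univ
  let f : ∀ σ : {σ : Finset V // K.IsFace σ}, MvPolynomial (Fin s) F →ₐ[F] MvPolynomial σ.1 F :=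
    fun σ => aeval fun i => restrictFace σ.2 (b i)
  have hf : ∀ σ p, f σ p = restrictFace σ.2 (aeval b p) := by
    intro σ p
    rw [← AlgHom.comp_apply]
    congr 1
    ext i
    simp [f]
  -- The restrictions are jointly injective, so the product of the kernels is zero. In a domain one
  -- kernel vanishes, and independence survives on that face, where the transcendence degree is |σ|.
  have hprod : ∏ σ ∈ faces, RingHom.ker (f σ) = ⊥ := by
    rw [eq_bot_iff]
    intro p hp
    have hzero : ∀ σ, f σ p = 0 := fun σ =>
      (Ideal.prod_le_inf.trans (Finset.inf_le (Finset.mem_univ σ))) hp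
    refine (Submodule.mem_bot _).2 (hb ?_)
    rw [map_zero]
    obtain ⟨q, hq⟩ := Ideal.Quotient.mk_surjective (aeval b p)
    rw [← hq, Ideal.Quotient.eq_zero_iff_mem]
    refine mem_stanleyReisnerIdeal_of_restrictPoly fun σ hσ => ?_
    have := hzero ⟨σ, hσ⟩
    rwa [hf, ← hq] at this
  obtain ⟨σ, -, hσ⟩ := Finset.prod_eq_zero_iff.1 (hprod.trans Ideal.zero_eq_bot.symm)
  refine ⟨σ.1, σ.2, ?_⟩
  have hind : AlgebraicIndependent F fun i => restrictFace σ.2 (b i) :=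
    (RingHom.injective_iff_ker_eq_bot (f σ)).2 hσ
  have hcard := hind.lift_cardinalMk_le_trdeg
  rw [MvPolynomial.trdeg_of_isDomain] at hcard
  simpa using hcard

theorem restrictPoly_esymm [Fintype V] (σ : Finset V) (j : ℕ) :
    restrictPoly F σ (esymm V F j) = esymm σ F j := by
  rw [esymm, map_sum, ← Finset.sum_subset (Finset.powersetCard_mono (Finset.subset_univ σ))]
  · have hσ : Finset.powersetCard j σ = (Finset.powersetCard j (Finset.univ : Finset σ)).map
        (Finset.mapEmbedding (Function.Embedding.subtype (· ∈ σ))).toEmbedding := by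
      rw [← Finset.powersetCard_map, Finset.univ_eq_attach]
      exact congrArg _ Finset.attach_map_val.symm
    rw [esymm, hσ, Finset.sum_map]
    refine Finset.sum_congr rfl fun t _ => ?_
    simp [restrictPoly]
  · intro t ht htσ
    have hsub : ¬ t ⊆ σ := fun h =>
      htσ (Finset.mem_powersetCard.2 ⟨h, (Finset.mem_powersetCard.1 ht).2⟩)
    obtain ⟨i, hi, hiσ⟩ := Finset.not_subset.1 hsub
    rw [map_prod]
    exact Finset.prod_eq_zero hi (by simp [restrictPoly, hiσ])

/-- Restricted to σ, these classes become the elementary symmetric polynomials in exactly n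
variables, which are independent by the fundamental theorem on symmetric polynomials. -/
theorem algebraicIndependent_esymm [Fintype V] {σ : Finset V} (hσ : K.IsFace σ) {n : ℕ}
    (hn : σ.card = n) :
    AlgebraicIndependent F fun i : Fin n =>
      (Ideal.Quotient.mk (K.stanleyReisnerIdeal F) (esymm V F (i + 1))) := by
  refine AlgebraicIndependent.of_comp (restrictFace hσ) ?_
  have : (restrictFace hσ ∘ fun i : Fin n =>
      (Ideal.Quotient.mk (K.stanleyReisnerIdeal F) (esymm V F (i + 1)))) =
      fun i : Fin n => esymm σ F (i + 1) := by
    ext1 i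
    exact restrictPoly_esymm σ _
  rw [this]
  intro p q hpq
  refine esymmAlgHom_injective F (σ := σ) (n := n) (by simp [hn]) (Subtype.ext ?_)
  rw [esymmAlgHom_apply, esymmAlgHom_apply]
  exact hpq

end Restriction

end PreAbstractSimplicialComplex

/-! ### Cohen-Macaulay and Gorenstein face rings in terms of polynomials -/

namespace Ideal

variable {R S : Type*} [CommRing R] [CommRing S]

theorem isRegularSeqMod_map_iff {f : R →+* S} (hf : Function.Surjective f) {J : Ideal S}
    {l : List R} : J.IsRegularSeqMod (l.map f) ↔ (J.comap f).IsRegularSeqMod l := by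
  induction l generalizing J with
  | nil => exact Iff.rfl
  | cons a l ih =>
    have hcomap : (J ⊔ span {f a}).comap f = J.comap f ⊔ span {a} := by
      rw [← Set.image_singleton, ← map_span, ← map_comap_of_surjective f hf J, ← Ideal.map_sup,
        comap_map_of_surjective f hf, map_comap_of_surjective f hf J]
      refine sup_eq_left.2 (le_sup_of_le_left ?_)
      exact comap_mono bot_le
    rw [List.map_cons, IsRegularSeqMod, IsRegularSeqMod, ih, hcomap]
    refine and_congr_left fun _ => ⟨fun h z hz => h (f z) ?_, fun h z hz => ?_⟩
    · rwa [mem_comap, map_mul] at hz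
    · obtain ⟨z, rfl⟩ := hf z
      exact h z (by rwa [mem_comap, map_mul])

theorem isWeaklyRegular_iff_isRegularSeqMod {l : List R} :
    RingTheory.Sequence.IsWeaklyRegular R l ↔ (⊥ : Ideal R).IsRegularSeqMod l := by
  induction l using List.reverseRecOn with
  | nil => exact iff_of_true (.nil R R) trivial
  | append_singleton l a ih =>
    rw [RingTheory.Sequence.isWeaklyRegular_append_iff,
      RingTheory.Sequence.isWeaklyRegular_singleton_iff, isRegularSeqMod_concat, ih,
      isRegularMod_iff_isSMulRegular, bot_sup_eq]
    refine and_congr_right fun _ => ?_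
    rw [smul_eq_mul, mul_top]

end Ideal

namespace PreAbstractSimplicialComplex

open MvPolynomial GradedPieces

variable {V : Type*} {K : PreAbstractSimplicialComplex V} {F : Type*} [Field F] {r : ℕ}

theorem ofList_ofFn (p : Fin r → MvPolynomial V F) :
    Ideal.ofList (List.ofFn p) = Ideal.span (Set.range p) := by
  rw [Ideal.ofList]
  congr 1
  ext x
  simp [List.mem_ofFn]

/-- The image in the face ring of a family of polynomials. -/
noncomputable def toFaceRing (K : PreAbstractSimplicialComplex V) (p : Fin r → MvPolynomial V F) :
    Fin r → K.FaceRing F :=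
  fun i => Ideal.Quotient.mk (K.stanleyReisnerIdeal F) (p i)

theorem mk_mem_span_toFaceRing_iff {p : Fin r → MvPolynomial V F} {z : MvPolynomial V F} :
    Ideal.Quotient.mk (K.stanleyReisnerIdeal F) z ∈ Ideal.span (Set.range (K.toFaceRing p)) ↔
      z ∈ K.stanleyReisnerIdeal F ⊔ Ideal.ofList (List.ofFn p) := by
  have : Set.range (K.toFaceRing p) =
      Ideal.Quotient.mk (K.stanleyReisnerIdeal F) '' Set.range p := by
    rw [← Set.range_comp]
    rfl
  rw [this, ← Ideal.map_span, Ideal.mem_quotient_iff_mem_sup, ofList_ofFn, sup_comm]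

theorem isWeaklyRegular_toFaceRing_iff {p : Fin r → MvPolynomial V F} :
    RingTheory.Sequence.IsWeaklyRegular (K.FaceRing F) (List.ofFn (K.toFaceRing p)) ↔
      (K.stanleyReisnerIdeal F).IsRegularSeqMod (List.ofFn p) := by
  have : List.ofFn (K.toFaceRing p) =
      (List.ofFn p).map (Ideal.Quotient.mk (K.stanleyReisnerIdeal F)) := by
    rw [List.map_ofFn]
    rfl
  rw [Ideal.isWeaklyRegular_iff_isRegularSeqMod, this,
    Ideal.isRegularSeqMod_map_iff Ideal.Quotient.mk_surjective, ← RingHom.ker_eq_comap_bot,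
    Ideal.mk_ker]

theorem mem_quotient_faceRingGrading_iff {I : Ideal (K.FaceRing F)} {j : ℕ}
    {x : K.FaceRing F ⧸ I} :
    x ∈ quotient (K.faceRingGrading F) I j ↔
      ∃ p, IsWeightedHomogeneous (fun _ : V => 2) p j ∧
        Ideal.Quotient.mk I (Ideal.Quotient.mk (K.stanleyReisnerIdeal F) p) = x := by
  constructor
  · rintro ⟨_, ⟨p, hp, rfl⟩, rfl⟩
    exact ⟨p, hp, rfl⟩
  · rintro ⟨p, hp, rfl⟩
    exact ⟨_, ⟨p, hp, rfl⟩, rfl⟩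

theorem mk_mk_eq_zero_iff {p : Fin r → MvPolynomial V F} {z : MvPolynomial V F} :
    Ideal.Quotient.mk (Ideal.span (Set.range (K.toFaceRing p)))
        (Ideal.Quotient.mk (K.stanleyReisnerIdeal F) z) = 0 ↔
      z ∈ K.stanleyReisnerIdeal F ⊔ Ideal.ofList (List.ofFn p) := by
  rw [Ideal.Quotient.eq_zero_iff_mem, mk_mem_span_toFaceRing_iff]

theorem mem_idealOfVars_of_isWeightedHomogeneous {p : MvPolynomial V F} {n : ℕ}
    (hp : IsWeightedHomogeneous (fun _ : V => 2) p n) (hn : n ≠ 0) : p ∈ idealOfVars V F := by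
  rw [mem_idealOfVars_iff, constantCoeff_eq]
  by_contra h
  have := hp h
  rw [map_zero] at this
  exact hn this.symm

theorem exists_isParameterList_of_isHsop {a : Fin r → K.FaceRing F}
    (ha : IsHsop (K.faceRingGrading F) a) :
    ∃ p : Fin r → MvPolynomial V F, K.toFaceRing p = a ∧ K.IsParameterList (List.ofFn p) := by
  classical
  choose n hn using ha.homogeneous
  choose p hp hpa using hn
  have hpa' : K.toFaceRing p = a := funext hpa
  -- An element of degree 0 is a scalar, hence algebraic over F, which independence forbids.
  have hn0 : ∀ i, n i ≠ 0 := by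
    intro i h0
    have hpi : IsWeightedHomogeneous (fun _ : V => 2) (p i) 0 := h0 ▸ hp i
    have hC : p i = C (constantCoeff (p i)) := by
      ext d
      rw [coeff_C]
      split_ifs with hd
      · rw [← hd, constantCoeff_eq]
      · by_contra hne
        have h1 := hpi hne
        have h2 := degree_le_weight (w := fun _ : V => 2) (by simp) d
        rw [h1] at h2
        exact hd ((Finsupp.degree_eq_zero_iff d).1 (by omega)).symm
    refine ha.algebraicIndependent.transcendental i ?_
    have : a i = algebraMap F (K.FaceRing F) (constantCoeff (p i)) := by
      rw [← hpa', toFaceRing, hC]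
      simp
      rfl
    rw [this]
    exact isAlgebraic_algebraMap _
  refine ⟨p, hpa', ?_, ?_, ?_⟩
  · simp only [List.forall_mem_ofFn_iff]
    exact fun i => mem_idealOfVars_of_isWeightedHomogeneous (hp i) (hn0 i)
  · simp only [List.forall_mem_ofFn_iff]
    exact fun i => ⟨n i, hp i⟩
  · refine idealOfVars_le_radical_of_forall_X fun i => ?_
    obtain ⟨⟨N, hN⟩, -⟩ := ha.finite_quotient
    refine ⟨N, ?_⟩
    rw [← mk_mk_eq_zero_iff, hpa']
    -- The power `X i ^ N` has degree 2N ≥ N, where the quotient already vanishes.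
    have hmem := mem_quotient_faceRingGrading_iff (K := K) (F := F)
      (I := Ideal.span (Set.range a)) (j := N * 2).2
      ⟨X i ^ N, (isWeightedHomogeneous_X F (fun _ : V => 2) i).pow N, rfl⟩
    rwa [hN _ (by omega), Submodule.mem_bot] at hmem

theorem IsParameterList.isHsop [Finite V] {p : Fin r → MvPolynomial V F}
    (hp : K.IsParameterList (List.ofFn p)) (hind : AlgebraicIndependent F (K.toFaceRing p)) :
    IsHsop (K.faceRingGrading F) (K.toFaceRing p) where
  homogeneous := fun i => by
    obtain ⟨n, hn⟩ := hp.homogeneous (p i) (by simp)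
    exact ⟨n, p i, hn, rfl⟩
  algebraicIndependent := hind
  finite_quotient := by
    constructor
    · obtain ⟨N, hN⟩ :=
        Ideal.exists_pow_le_of_le_radical_of_fg hp.le_radical (idealOfVars_fg V F)
      refine ⟨2 * N, fun j hj => (Submodule.eq_bot_iff _).2 fun x hx => ?_⟩
      obtain ⟨q, hq, rfl⟩ := mem_quotient_faceRingGrading_iff.1 hx
      rw [mk_mk_eq_zero_iff]
      refine hN ((mem_pow_idealOfVars_iff N q).2 fun d hd => ?_)
      have h1 := hq (mem_support_iff.1 hd)
      have h2 : Finsupp.weight (fun _ : V => 2) d = d.degree * 2 := by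
        rw [Finsupp.weight_apply, Finsupp.degree_apply, Finsupp.sum, Finset.sum_mul]
        rfl
      omega
    · intro j
      have h1 : (weightedHomogeneousSubmodule F (fun _ : V => 2) j).FG :=
        weightedHomogeneousSubmodule_fg _ _ (by simp) j
      exact Module.Finite.iff_fg.2 ((h1.map _).map _)

theorem nonempty_linearEquiv_self_iff {M : Type*} [AddCommGroup M] [Module F M] :
    Nonempty (M ≃ₗ[F] F) ↔ ∃ u : M, u ≠ 0 ∧ ∀ z : M, ∃ c : F, c • u = z := by
  rw [← finrank_eq_one_iff']
  constructor
  · rintro ⟨e⟩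
    rw [e.finrank_eq, Module.finrank_self]
  · intro h
    have := Module.finite_of_finrank_eq_succ h
    exact FiniteDimensional.nonempty_linearEquiv_of_finrank_eq
      (h.trans (Module.finrank_self F).symm)

/-- Being killed by all positive degrees is the same as being killed by the variables, so the socle
can be computed on polynomial representatives. -/
theorem nonempty_socle_equiv_iff {p : Fin r → MvPolynomial V F} :
    Nonempty (socle (quotient (K.faceRingGrading F)
        (Ideal.span (Set.range (K.toFaceRing p)))) ≃ₗ[F] F) ↔
      Ideal.HasCyclicSocle (C : F → MvPolynomial V F) (idealOfVars V F)
        (K.stanleyReisnerIdeal F ⊔ Ideal.ofList (List.ofFn p)) := by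
  set I := Ideal.span (Set.range (K.toFaceRing p))
  set J := K.stanleyReisnerIdeal F ⊔ Ideal.ofList (List.ofFn p)
  let π : MvPolynomial V F →ₐ[F] K.FaceRing F ⧸ I :=
    (Ideal.Quotient.mkₐ F I).comp (Ideal.Quotient.mkₐ F (K.stanleyReisnerIdeal F))
  have hπ : ∀ {z}, π z = 0 ↔ z ∈ J := mk_mk_eq_zero_iff
  have hsurj : Function.Surjective π :=
    (Ideal.Quotient.mkₐ_surjective F I).comp (Ideal.Quotient.mkₐ_surjective F _)
  have hsoc : ∀ z, π z ∈ socle (quotient (K.faceRingGrading F) I) ↔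
      ∀ x ∈ idealOfVars V F, x * z ∈ J := by
    intro z
    constructor
    · intro h
      rw [forall_mem_idealOfVars_mul_mem_iff]
      intro i
      rw [← hπ, map_mul]
      exact h 2 two_pos _ (mem_quotient_faceRingGrading_iff.2
        ⟨X i, isWeightedHomogeneous_X F _ i, rfl⟩)
    · intro h j hj c hc
      obtain ⟨q, hq, rfl⟩ := mem_quotient_faceRingGrading_iff.1 hc
      change π q * π z = 0
      rw [← map_mul, hπ]
      exact h q (mem_idealOfVars_of_isWeightedHomogeneous hq hj.ne')
  have hsmul : ∀ (c : F) u, c • π u = π (C c * u) := by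
    intro c u
    rw [← map_smul, smul_eq_C_mul]
  rw [nonempty_linearEquiv_self_iff]
  constructor
  · rintro ⟨⟨u, hu⟩, hne, hspan⟩
    obtain ⟨u, rfl⟩ := hsurj u
    refine ⟨u, fun h => hne (Subtype.ext (hπ.2 h)), (hsoc u).1 hu, fun z hz => ?_⟩
    obtain ⟨c, hc⟩ := hspan ⟨π z, (hsoc z).2 hz⟩
    refine ⟨c, ?_⟩
    rw [← hπ, map_sub, ← hsmul, sub_eq_zero]
    exact (congrArg Subtype.val hc).symm
  · rintro ⟨u, hu, hmu, hspan⟩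
    refine ⟨⟨π u, (hsoc u).2 hmu⟩, fun h => hu (hπ.1 (congrArg Subtype.val h)), ?_⟩
    rintro ⟨z, hz⟩
    obtain ⟨z, rfl⟩ := hsurj z
    obtain ⟨c, hc⟩ := hspan z ((hsoc z).1 hz)
    refine ⟨c, Subtype.ext ?_⟩
    rw [← hπ, map_sub, ← hsmul, sub_eq_zero] at hc
    exact hc.symm

/-! ### Links of vertices and faces -/

/-- A regular homogeneous system of parameters of length `r`, given by polynomials. -/
def HasRegularParameters (K : PreAbstractSimplicialComplex V) (F : Type*) [Field F] (r : ℕ) :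
    Prop :=
  ∃ p : Fin r → MvPolynomial V F, IsHsop (K.faceRingGrading F) (K.toFaceRing p) ∧
    K.IsParameterList (List.ofFn p) ∧ (K.stanleyReisnerIdeal F).IsRegularSeqMod (List.ofFn p)

theorem isCohenMacaulay_iff :
    IsCohenMacaulay (K.faceRingGrading F) ↔ ∃ r, K.HasRegularParameters F r := by
  constructor
  · rintro ⟨r, a, ha, hreg⟩
    obtain ⟨p, rfl, hp⟩ := exists_isParameterList_of_isHsop ha
    exact ⟨r, p, ha, hp, isWeaklyRegular_toFaceRing_iff.1 hreg⟩
  · rintro ⟨r, p, ha, -, hreg⟩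
    exact ⟨r, _, ha, isWeaklyRegular_toFaceRing_iff.2 hreg⟩

/-- A property of complexes inherited by links of vertices is inherited by links of faces. -/
theorem link_induction [DecidableEq V] {P : PreAbstractSimplicialComplex V → Prop}
    (hP : ∀ (K : PreAbstractSimplicialComplex V) (v : V), K.IsFace {v} → P K → P (K.link {v}))
    (h : P K) {τ : Finset V} (hτ : K.IsFace τ) : P (K.link τ) := by
  induction τ using Finset.induction_on with
  | empty => rwa [link_empty]
  | insert v τ hv ih =>
    obtain ⟨hv', heq⟩ := link_insert hv hτ
    rw [heq]
    exact hP _ v hv' (ih (hτ.mono (Finset.subset_insert v τ)))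

variable [Finite V]

theorem exists_isFace_card_maximal (K : PreAbstractSimplicialComplex V) :
    ∃ σ, K.IsFace σ ∧ ∀ τ, K.IsFace τ → τ.card ≤ σ.card := by
  classical
  have := Fintype.ofFinite V
  obtain ⟨σ, hσ, hmax⟩ := ({σ | K.IsFace σ} : Finset (Finset V)).exists_max_image Finset.card
    ⟨∅, by simpa using K.isFace_empty⟩
  exact ⟨σ, by simpa using hσ, fun τ hτ => hmax τ (by simpa using hτ)⟩

variable [DecidableEq V]

/-- All systems of parameters of the link of a vertex are one shorter than a regular system of
parameters of the complex. -/
theorem exists_isFace_link_card {v : V} (hv : K.IsFace {v}) (hK : K.HasRegularParameters F r) :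
    ∃ σ, (K.link {v}).IsFace σ ∧ (∀ τ, (K.link {v}).IsFace τ → τ.card ≤ σ.card) ∧
      r = σ.card + 1 := by
  have := Fintype.ofFinite V
  obtain ⟨p, -, hp, hreg⟩ := hK
  obtain ⟨σ, hσ, hmax⟩ := (K.link {v}).exists_isFace_card_maximal
  refine ⟨σ, hσ, hmax, le_antisymm ?_ ?_⟩
  · simpa using length_le_of_link hv hp hreg (isParameterList_esymm hmax)
  · rw [isFace_link_singleton hv] at hσ
    have := hσ.2.card_le hp
    rwa [Finset.card_insert_of_notMem hσ.1, List.length_ofFn] at this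

theorem HasRegularParameters.link {v : V} (hv : K.IsFace {v})
    (hK : K.HasRegularParameters F (r + 1)) : (K.link {v}).HasRegularParameters F r := by
  have := Fintype.ofFinite V
  obtain ⟨σ, hσ, hmax, hr⟩ := exists_isFace_link_card hv hK
  obtain rfl : r = σ.card := by omega
  obtain ⟨p, -, hp, hreg⟩ := hK
  have hb := isParameterList_esymm (F := F) hmax
  exact ⟨_, hb.isHsop (algebraicIndependent_esymm hσ rfl), hb,
    isRegularSeqMod_link hv hp hreg hb (by simp)⟩

theorem isCohenMacaulay_link_singleton {v : V} (hv : K.IsFace {v})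
    (h : IsCohenMacaulay (K.faceRingGrading F)) :
    IsCohenMacaulay ((K.link {v}).faceRingGrading F) := by
  rw [isCohenMacaulay_iff] at h ⊢
  obtain ⟨r, hr⟩ := h
  obtain ⟨σ, -, -, rfl⟩ := exists_isFace_link_card hv hr
  exact ⟨_, hr.link hv⟩

theorem isGorenstein_link_singleton {v : V} (hv : K.IsFace {v})
    (h : IsGorenstein (K.faceRingGrading F)) :
    IsGorenstein ((K.link {v}).faceRingGrading F) := by
  refine ⟨isCohenMacaulay_link_singleton hv h.1, fun s b hb => ?_⟩
  obtain ⟨r, hr⟩ := isCohenMacaulay_iff.1 h.1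
  obtain ⟨σ, hσ, hmax, hrσ⟩ := exists_isFace_link_card hv hr
  obtain ⟨p, hph, hp, hreg⟩ := hr
  obtain ⟨q, rfl, hq⟩ := exists_isParameterList_of_isHsop hb
  -- The definition quantifies over all systems of parameters of the link, so each must have the
  -- expected length: independence bounds it above by the largest face, and `IsFace.card_le` below.
  have hs : s = σ.card := by
    apply le_antisymm
    · obtain ⟨τ, hτ, hsτ⟩ := exists_isFace_le_card hb.algebraicIndependent
      exact hsτ.trans (hmax τ hτ)
    · simpa using hσ.card_le hq
  rw [nonempty_socle_equiv_iff]
  exact hasCyclicSocle_link hv hp hreg hq (by simp [hs, hrσ])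
    (nonempty_socle_equiv_iff.1 (h.2 r _ hph))

/-- Removing v from a facet leaves a facet of the link of v, whose regular systems of parameters are
one shorter; induction ends at the empty facet. -/
theorem HasRegularParameters.card_eq {τ : Finset V} (hτ : Maximal K.IsFace τ)
    (hK : K.HasRegularParameters F r) : τ.card = r := by
  induction hn : τ.card generalizing K r τ with
  | zero =>
    obtain rfl := Finset.card_eq_zero.1 hn
    obtain ⟨p, -, hp, hreg⟩ := hK
    -- If ∅ is maximal, no singleton is a face, so every variable lies in the ideal; the empty list
    -- of parameters then forces r = 0.
    have hnil : K.IsParameterList ([] : List (MvPolynomial V F)) := by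
      refine ⟨by simp, by simp, idealOfVars_le_radical_of_forall_X fun i => ?_⟩
      refine Ideal.le_radical
        (Submodule.mem_sup_left (Ideal.subset_span ⟨{i}, fun hi => ?_, by simp⟩))
      have := hτ.2 hi (by simp)
      simp at this
    have := hreg.length_le_of_le_radical stanleyReisnerIdeal_le_idealOfVars hp.mem hnil.mem
      hnil.le_radical
    simpa [eq_comm] using this
  | succ n ih =>
    obtain ⟨v, hv⟩ := Finset.card_pos.1 (by omega : 0 < τ.card)
    have hvK : K.IsFace {v} := hτ.1.mono (by simpa using hv)
    obtain ⟨σ, -, -, rfl⟩ := exists_isFace_link_card hvK hK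
    rw [Nat.add_right_cancel_iff]
    refine ih (τ := τ.erase v) ⟨?_, fun ρ hρ hle => ?_⟩ (hK.link hvK)
      (by rw [Finset.card_erase_of_mem hv]; omega)
    · rw [isFace_link_singleton hvK, Finset.insert_erase hv]
      exact ⟨Finset.notMem_erase v τ, hτ.1⟩
    · rw [isFace_link_singleton hvK] at hρ
      have h1 : τ ⊆ insert v ρ := by
        rw [← Finset.insert_erase hv]
        exact Finset.insert_subset_insert v hle
      have h2 : insert v ρ ⊆ τ := hτ.2 hρ.2 h1
      exact Finset.subset_erase.2 ⟨(Finset.subset_insert v ρ).trans h2, hρ.1⟩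

theorem isPure_of_isCohenMacaulay (h : IsCohenMacaulay (K.faceRingGrading F)) : K.IsPure := by
  obtain ⟨r, hr⟩ := isCohenMacaulay_iff.1 h
  exact fun σ τ hσ hτ => (hr.card_eq hσ).trans (hr.card_eq hτ).symm

end PreAbstractSimplicialComplex

theorem corollary6p3 {F : Type*} [Field F] {V : Type*} [Finite V] [DecidableEq V]
    (K : PreAbstractSimplicialComplex V) :
    (GradedPieces.IsCohenMacaulay (K.faceRingGrading F) →
      K.IsPure ∧ ∀ τ : Finset V, K.IsFace τ →
        GradedPieces.IsCohenMacaulay ((K.link τ).faceRingGrading F)) ∧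
    (GradedPieces.IsGorenstein (K.faceRingGrading F) →
      K.IsPure ∧ ∀ τ : Finset V, K.IsFace τ →
        GradedPieces.IsGorenstein ((K.link τ).faceRingGrading F)) := by
  refine ⟨fun h => ⟨PreAbstractSimplicialComplex.isPure_of_isCohenMacaulay h, fun τ hτ => ?_⟩,
    fun h => ⟨PreAbstractSimplicialComplex.isPure_of_isCohenMacaulay h.1, fun τ hτ => ?_⟩⟩
  · exact PreAbstractSimplicialComplex.link_induction
      (P := fun L => GradedPieces.IsCohenMacaulay (L.faceRingGrading F))
      (fun L v hv hL => PreAbstractSimplicialComplex.isCohenMacaulay_link_singleton hv hL) h hτ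
  · exact PreAbstractSimplicialComplex.link_induction
      (P := fun L => GradedPieces.IsGorenstein (L.faceRingGrading F))
      (fun L v hv hL => PreAbstractSimplicialComplex.isGorenstein_link_singleton hv hL) h hτ
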